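/- Let $\gamma\in(0,1)$, $s\in(0,1/2)$, $c_b>0$, $k>2$ be real numbers, and write $\langle v\rangle=(1+|v|^2)^{1/2}$ and $m(v)=\langle v\rangle^k$ for $v\in\mathbb R^3$. Let $b$ be a Borel measurable angular function that vanishes for $\cos\theta<0$ and satisfies $$\forall\,\theta\in(0,\pi/2],\qquad \frac{c_b}{\theta^{1+2s}}\le \sin\theta\; b(\cos\theta)\le \frac{1}{c_b\,\theta^{1+2s}},$$ and let $B(z,\sigma)=|z|^\gamma\, b(\langle z/|z|,\sigma\rangle)$ for $z\in\mathbb R^3\setminus\{0\}$, $\sigma\in\mathbb S^2$. For $h:\mathbb R^3\to\mathbb R$ put $$Q(h,h)(v)=\int_{\mathbb R^3\times\mathbb S^2}B(v-v_*,\sigma)\,\big[h(v_*')h(v')-h(v_*)h(v)\big]\,d\sigma\,dv_*,\qquad v'=\tfrac{v+v_*}2+\tfrac{|v-v_*|}2\sigma,\quad v'_*=\tfrac{v+v_*}2-\tfrac{|v-v_*|}2\sigma .$$ For a weight $w>0$ let $\|h\|_{L^1(w)}=\|h\,w\|_{L^1(\mathbb R^3)}$ and let $\|h\|_{H^4(w)}=\big(\sum_{|\alpha|\le4}\|w\,\partial^\alpha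 h\|_{L^2(\mathbb R^3)}^2\big)^{1/2}$ be the norm of the weighted Sobolev space $H^4(w)$ (weak derivatives). Then there is a constant $C>0$, which may depend on $B$ and $k$ but not on $h$, such that for every $h\in H^4(\langle v\rangle^{4\gamma+k+6})$ the integral defining $Q(h,h)(v)$ converges absolutely for almost every $v$, $Q(h,h)\in L^1(m)$, and $$\|Q(h,h)\|_{L^1(m)}\le C\Big(\|h\|_{L^1(m)}^{3/2}\,\|h\|_{L^1(\langle v\rangle^{2\gamma}m)}^{1/2}+\|h\|_{L^1(m)}^{3/2}\,\|h\|_{H^4(\langle v\rangle^{4\gamma+k+6})}^{1/2}\Big).$$ -/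

import Mathlib

open MeasureTheory
open scoped ENNReal ContDiff

noncomputable section

namespace Boltzmann

/-- Velocity space `ℝ³` with its Euclidean norm. -/
abbrev Vel : Type := EuclideanSpace ℝ (Fin 3)

/-- The unit sphere of `ℝ³`. -/
abbrev Sph : Type := Metric.sphere (0 : Vel) 1

/-- The surface measure on the unit sphere. -/
def surfaceMeasure : Measure Sph := (volume : Measure Vel).toSphere

/-- The Japanese bracket `⟨v⟩ = (1 + |v|²)^{1/2}`. -/
def bracket (v : Vel) : ℝ := Real.sqrt (1 + ‖v‖ ^ 2)

/-- The polynomial weight `v ↦ ⟨v⟩ ^ q`, for a real exponent `q`. -/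
def polyWeight (q : ℝ) (v : Vel) : ℝ := bracket v ^ q

/-! ### The collision operator -/

/-- Post-collisional velocity `v' = (v + v_*)/2 + |v - v_*|/2 σ`. -/
def postVel (v vs : Vel) (σ : Sph) : Vel :=
  (1 / 2 : ℝ) • (v + vs) + (‖v - vs‖ / 2) • (σ : Vel)

/-- Post-collisional velocity `v'_* = (v + v_*)/2 - |v - v_*|/2 σ`. -/
def postVelStar (v vs : Vel) (σ : Sph) : Vel :=
  (1 / 2 : ℝ) • (v + vs) - (‖v - vs‖ / 2) • (σ : Vel)

/-- The integrand of `Q(g, f)(v)` at `(v_*, σ)`, for a collision kernel `B`. -/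
def collisionIntegrand (B : Vel → Sph → ℝ) (g f : Vel → ℝ) (v : Vel) (p : Vel × Sph) : ℝ :=
  B (v - p.1) p.2 *
    (g (postVelStar v p.1 p.2) * f (postVel v p.1 p.2) - g p.1 * f v)

/-- The Boltzmann collision operator
`Q(g, f)(v) = ∫_{ℝ³ × 𝕊²} B(v - v_*, σ) (g'_* f' - g_* f) dσ dv_*`. -/
def collisionOperator (B : Vel → Sph → ℝ) (g f : Vel → ℝ) (v : Vel) : ℝ :=
  ∫ p, collisionIntegrand B g f v p ∂((volume : Measure Vel).prod surfaceMeasure)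

/-- `cos θ = ⟨κ, σ⟩` with `κ = z / |z|`, for the relative velocity `z`. -/
def cosDeviation (z : Vel) (σ : Sph) : ℝ := inner ℝ (‖z‖⁻¹ • z) (σ : Vel)

/-- The product kernel `B(z, σ) = |z|^γ b(cos θ)`. -/
def hardPotentialKernel (γ : ℝ) (b : ℝ → ℝ) (z : Vel) (σ : Sph) : ℝ :=
  ‖z‖ ^ γ * b (cosDeviation z σ)

/-- Angular functions with a singularity of order `s`: `b` is supported in `cos θ ≥ 0`, and
`c_b θ^{-1-2s} ≤ sin θ b(cos θ) ≤ c_b⁻¹ θ^{-1-2s}` for `θ ∈ (0, π/2]`. -/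
structure IsAngularFunction (s c : ℝ) (b : ℝ → ℝ) : Prop where
  measurable : Measurable b
  eq_zero_of_neg : ∀ x, x < 0 → b x = 0
  lower : ∀ θ, 0 < θ → θ ≤ Real.pi / 2 →
    c / θ ^ (1 + 2 * s) ≤ Real.sin θ * b (Real.cos θ)
  upper : ∀ θ, 0 < θ → θ ≤ Real.pi / 2 →
    Real.sin θ * b (Real.cos θ) ≤ 1 / (c * θ ^ (1 + 2 * s))

/-! ### Weighted Lebesgue and Sobolev spaces -/

/-- The norm `‖h‖_{L^p(w)} = ‖h w‖_{L^p}`, with values in `[0, ∞]`. -/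
def weightedLpNorm (p : ℝ≥0∞) (w h : Vel → ℝ) : ℝ≥0∞ :=
  eLpNorm (fun v => h v * w v) p volume

/-- The classical partial derivative `∂_i φ`. -/
def partialDeriv (i : Fin 3) (φ : Vel → ℝ) (v : Vel) : ℝ :=
  fderiv ℝ φ v (EuclideanSpace.single i 1)

/-- The classical iterated derivative `∂^α φ` for a multi-index `α`. -/
def iteratedPartial (α : Fin 3 → ℕ) (φ : Vel → ℝ) : Vel → ℝ :=
  (partialDeriv 0)^[α 0] ((partialDeriv 1)^[α 1] ((partialDeriv 2)^[α 2] φ))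

/-- `g` is a weak derivative `∂^α h`. -/
structure IsWeakDeriv (α : Fin 3 → ℕ) (h g : Vel → ℝ) : Prop where
  locallyIntegrable : LocallyIntegrable h volume
  locallyIntegrable_deriv : LocallyIntegrable g volume
  integral_eq : ∀ φ : Vel → ℝ, ContDiff ℝ ∞ φ → HasCompactSupport φ →
    ∫ v, h v * iteratedPartial α φ v = (-1) ^ (∑ i, α i) * ∫ v, g v * φ v

open Classical in
/-- The weak derivative `∂^α h` (unique almost everywhere); it is `0` if there is none. -/
def weakDeriv (α : Fin 3 → ℕ) (h : Vel → ℝ) : Vel → ℝ :=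
  if H : ∃ g, IsWeakDeriv α h g then H.choose else 0

/-- The finite set of multi-indices `α` with `|α| ≤ N`. -/
def multiIndices (N : ℕ) : Finset (Fin 3 → ℕ) :=
  (Fintype.piFinset fun _ => Finset.range (N + 1)).filter fun α => ∑ i, α i ≤ N

theorem mem_multiIndices {N : ℕ} {α : Fin 3 → ℕ} : α ∈ multiIndices N ↔ ∑ i, α i ≤ N := by
  simp only [multiIndices, Finset.mem_filter, Fintype.mem_piFinset, Finset.mem_range,
    and_iff_right_iff_imp]
  intro h i
  have := Finset.single_le_sum (f := α) (fun j _ => Nat.zero_le _) (Finset.mem_univ i)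
  omega

/-- `h ∈ W^{N,p}(w)`: the weak derivatives of order at most `N` exist and lie in `L^p(w)`. -/
def MemWeightedSobolev (N : ℕ) (p : ℝ≥0∞) (w h : Vel → ℝ) : Prop :=
  ∀ α ∈ multiIndices N,
    (∃ g, IsWeakDeriv α h g) ∧ MemLp (fun v => weakDeriv α h v * w v) p volume

/-- The norm `(∑_{|α| ≤ N} ‖∂^α h‖_{L^p(w)}^p)^{1/p}` of `W^{N,p}(w)`, for `1 ≤ p < ∞` and
`h ∈ W^{N,p}(w)`. -/
def weightedSobolevNorm (N : ℕ) (p : ℝ≥0∞) (w h : Vel → ℝ) : ℝ≥0∞ :=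
  (∑ α ∈ multiIndices N, weightedLpNorm p w (weakDeriv α h) ^ p.toReal) ^ (1 / p.toReal)

/-- `h ∈ H^N(w) = W^{N,2}(w)`. -/
abbrev MemWeightedH (N : ℕ) (w h : Vel → ℝ) : Prop := MemWeightedSobolev N 2 w h

/-- The norm of `H^N(w) = W^{N,2}(w)`. -/
abbrev weightedHNorm (N : ℕ) (w h : Vel → ℝ) : ℝ≥0∞ := weightedSobolevNorm N 2 w h

end Boltzmann

end

open Boltzmann

/-!
The collision integrand is split as
`h'_* h' - h_* h = h_* (h' - h) + h' (h'_* - h_*)`. The measure `dv dv_* dσ` is invariant under the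
passage to the velocities after the collision (`lintegral_postVel`), which turns the second term
into `h (h_* - h'_*)` with the weight taken at `v'`; so in both terms one factor is unchanged by the
collision and the other one occurs through a difference. With `z = v - v_*`, the difference is an
integral of `∇h` along the segment from `z` to `(z + |z| σ) / 2`, whose length is
`|z| |z / |z| - σ| / 2`. This length lowers the singularity of `b` from order `2 + 2 s` to order
`1 + 2 s < 2`, which is integrable on the sphere (`exists_lintegral_angularKernel_le`). For fixed `σ`
and a fixed time on the segment, the map from `z` to the point of the segment expands distances up
to a constant on the half space where `b` is supported, and it decreases the angle to `σ`, so the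
integral over `z` is bounded by an integral over that point (`exists_lintegral_kernel_mul_sub_le`).
This gives, for `h` continuously differentiable and with `a = γ + 1`,
`‖Q(h,h)‖_{L¹(⟨v⟩^k)} ≤ C ‖h‖_{L¹(⟨v⟩^{k+a})} ‖∇h‖_{L¹(⟨v⟩^{k+a})}`
(`exists_lintegral_collisionIntegrand_le`).

Each factor is then interpolated between `L¹(⟨v⟩^k)`, with exponent `3 / 4`, and a norm of `h` or
`∂_i⁴ h` in `L¹(⟨v⟩^{k+4a})`, with exponent `1 / 4`. For the first factor this is Hölder's
inequality. For the gradient (`exists_weightedLpNorm_partialDeriv_le`), a four-point difference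
quotient with step `r` in an outward direction bounds the integral of `|∂_i h|` over `{⟨v⟩ ≥ R}` by
`r⁻¹ ∫ |h| + r³ ∫ |∂_i⁴ h|` over the same set; the choice `r = δ R^a` and summation over dyadic `R`
give the weighted bound with `δ⁻¹` and `δ³`, and `δ` is optimised. The product of the two factors has
the exponents `3 / 2` and `1 / 2`. Since `k + 4 a + 2 = 4 γ + k + 6` and `⟨v⟩^{-2}` lies in `L²(ℝ³)`,
the high order norms are bounded by the norm of `H⁴(⟨v⟩^{4γ+k+6})`. So the second summand of the
right-hand side suffices.

A general `h` is mollified: its mollifications have comparable weighted norms, mollification commutes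
with weak derivatives, and Fatou's lemma carries the bound of the integral of the absolute value of
the integrand over to `h`, which also gives absolute convergence.
-/

open Boltzmann

namespace Boltzmann

/-! ### The Japanese bracket -/

theorem one_le_bracket (v : Vel) : 1 ≤ bracket v := by
  rw [bracket, Real.one_le_sqrt]
  nlinarith [sq_nonneg ‖v‖]

theorem bracket_pos (v : Vel) : 0 < bracket v := zero_lt_one.trans_le (one_le_bracket v)

theorem norm_le_bracket (v : Vel) : ‖v‖ ≤ bracket v :=
  Real.le_sqrt_of_sq_le (by linarith)

theorem bracket_le_of_norm_le {v w : Vel} (h : ‖v‖ ≤ ‖w‖) : bracket v ≤ bracket w := by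
  unfold bracket
  gcongr

theorem bracket_le_add_norm_sub (v w : Vel) : bracket v ≤ bracket w + ‖v - w‖ := by
  have hw := bracket_pos w
  have hw2 : bracket w ^ 2 = 1 + ‖w‖ ^ 2 := Real.sq_sqrt (by positivity)
  have h1 : ‖v‖ ≤ ‖w‖ + ‖v - w‖ := by
    simpa using norm_add_le w (v - w)
  rw [bracket, Real.sqrt_le_left (by positivity)]
  nlinarith [norm_le_bracket w, norm_nonneg (v - w), norm_nonneg v, norm_nonneg w]

theorem continuous_bracket : Continuous bracket := by
  unfold bracket
  fun_prop

theorem continuous_polyWeight (q : ℝ) : Continuous (polyWeight q) :=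
  continuous_bracket.rpow_const fun v => Or.inl (bracket_pos v).ne'

theorem polyWeight_pos (q : ℝ) (v : Vel) : 0 < polyWeight q v :=
  Real.rpow_pos_of_pos (bracket_pos v) q

theorem polyWeight_add (p q : ℝ) (v : Vel) :
    polyWeight (p + q) v = polyWeight p v * polyWeight q v :=
  Real.rpow_add (bracket_pos v) p q

/-! ### The singular integral over the sphere -/

instance : IsFiniteMeasure surfaceMeasure := by
  unfold surfaceMeasure
  infer_instance

open scoped Pointwise in
/-- A spherical cap of radius `r` has surface `O(r²)`: the cone over it is covered by `O(1 / r)`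
balls of radius `2 r` centred on its axis. -/
theorem exists_surfaceMeasure_ball_le : ∃ C : ℝ, 0 < C ∧ ∀ (κ : Sph) (r : ℝ), 0 < r → r ≤ 2 →
    surfaceMeasure {σ : Sph | ‖(κ : Vel) - σ‖ < r} ≤ ENNReal.ofReal (C * r ^ 2) := by
  set V : ℝ := volume.real (Metric.ball (0 : Vel) 1) with hV
  have hV0 : 0 < V := by
    rw [hV, measureReal_def, ENNReal.toReal_pos_iff]
    exact ⟨Metric.measure_ball_pos _ _ one_pos, measure_ball_lt_top⟩
  refine ⟨72 * V, by positivity, fun κ r hr hr2 => ?_⟩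
  have hmeas : MeasurableSet {σ : Sph | ‖(κ : Vel) - σ‖ < r} :=
    (isOpen_lt (by fun_prop) continuous_const).measurableSet
  rw [surfaceMeasure, Measure.toSphere_apply' _ hmeas]
  have hcover : Set.Ioo (0 : ℝ) 1 • ((↑) '' {σ : Sph | ‖(κ : Vel) - σ‖ < r} : Set Vel) ⊆
      ⋃ j ∈ Finset.range (⌊1 / r⌋₊ + 1), Metric.ball (((j : ℝ) * r) • (κ : Vel)) (2 * r) := by
    rintro x ⟨ρ, hρ, _, ⟨σ, hσ, rfl⟩, rfl⟩
    simp only [Set.mem_iUnion, Finset.mem_range, Metric.mem_ball]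
    refine ⟨⌊ρ / r⌋₊, Nat.lt_succ_of_le (Nat.floor_le_floor (by gcongr; exact hρ.2.le)), ?_⟩
    have h1 : (⌊ρ / r⌋₊ : ℝ) * r ≤ ρ := by
      rw [← le_div_iff₀ hr]
      exact Nat.floor_le (div_nonneg hρ.1.le hr.le)
    have h2 : ρ < (⌊ρ / r⌋₊ : ℝ) * r + r := by
      have := Nat.lt_floor_add_one (ρ / r)
      rw [div_lt_iff₀ hr] at this
      linarith
    have hκ : ‖(κ : Vel)‖ = 1 := by simp
    have hσ' : ‖(κ : Vel) - σ‖ < r := hσ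
    have e : ρ • (σ : Vel) - ((⌊ρ / r⌋₊ : ℝ) * r) • (κ : Vel) =
        (ρ - (⌊ρ / r⌋₊ : ℝ) * r) • (κ : Vel) - ρ • ((κ : Vel) - σ) := by
      module
    change dist (ρ • (σ : Vel)) _ < _
    rw [dist_eq_norm, e]
    calc _ ≤ ‖(ρ - (⌊ρ / r⌋₊ : ℝ) * r) • (κ : Vel)‖ + ‖ρ • ((κ : Vel) - σ)‖ := norm_sub_le _ _
      _ = (ρ - (⌊ρ / r⌋₊ : ℝ) * r) + ρ * ‖(κ : Vel) - σ‖ := by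
        rw [norm_smul, norm_smul, hκ, Real.norm_of_nonneg (by linarith),
          Real.norm_of_nonneg hρ.1.le, mul_one]
      _ < 2 * r := by nlinarith [hρ.1, hρ.2, norm_nonneg ((κ : Vel) - σ)]
  have hball : ∀ j : ℕ, volume (Metric.ball (((j : ℝ) * r) • (κ : Vel)) (2 * r)) =
      ENNReal.ofReal (8 * r ^ 3 * V) := by
    intro j
    rw [Measure.addHaar_ball _ _ (by positivity), finrank_euclideanSpace, Fintype.card_fin, hV,
      ENNReal.ofReal_mul (by positivity), ofReal_measureReal]
    congr 2
    ring
  have hcount : ((⌊1 / r⌋₊ + 1 : ℕ) : ℝ) ≤ 3 / r := by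
    have := Nat.floor_le (show (0 : ℝ) ≤ 1 / r by positivity)
    push_cast
    have h3 : 1 ≤ 2 / r := by rwa [le_div_iff₀ hr, one_mul]
    have h4 : 3 / r = 1 / r + 2 / r := by ring
    linarith
  calc _ ≤ (3 : ℝ≥0∞) * ∑ j ∈ Finset.range (⌊1 / r⌋₊ + 1),
        volume (Metric.ball (((j : ℝ) * r) • (κ : Vel)) (2 * r)) := by
        rw [finrank_euclideanSpace, Fintype.card_fin]
        exact mul_le_mul_right ((measure_mono hcover).trans (measure_biUnion_finset_le _ _)) _
    _ = ENNReal.ofReal (3 * (((⌊1 / r⌋₊ + 1 : ℕ) : ℝ) * (8 * r ^ 3 * V))) := by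
        simp only [hball, Finset.sum_const, Finset.card_range, nsmul_eq_mul]
        rw [ENNReal.ofReal_mul (p := 3) (by norm_num),
          ENNReal.ofReal_mul (p := ((⌊1 / r⌋₊ + 1 : ℕ) : ℝ)) (by positivity),
          ENNReal.ofReal_natCast, ENNReal.ofReal_ofNat]
    _ ≤ ENNReal.ofReal (72 * V * r ^ 2) := by
        apply ENNReal.ofReal_le_ofReal
        calc _ ≤ 3 * (3 / r * (8 * r ^ 3 * V)) := by gcongr
          _ = 72 * V * r ^ 2 := by field_simp; ring

/-- The kernel `|u / |u| - σ| ^ {-p}`, singular at the direction of `u`. -/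
noncomputable def angularKernel (p : ℝ) (u σ : Vel) : ℝ≥0∞ := ENNReal.ofReal ‖‖u‖⁻¹ • u - σ‖ ^ (-p)

theorem measurable_angularKernel (p : ℝ) :
    Measurable fun x : Vel × Vel => angularKernel p x.1 x.2 := by
  unfold angularKernel
  fun_prop

/-- On a two-dimensional sphere a singularity of order less than two is integrable, uniformly in
its position. -/
theorem exists_lintegral_angularKernel_le {p : ℝ} (hp0 : 0 < p) (hp : p < 2) :
    ∃ C : ℝ≥0∞, C ≠ ⊤ ∧ ∀ u : Vel, u ≠ 0 →
      ∫⁻ σ : Sph, angularKernel p u σ ∂surfaceMeasure ≤ C := by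
  obtain ⟨C, hC, hcap⟩ := exists_surfaceMeasure_ball_le
  set q : ℝ := 2 ^ (p - 2) with hq
  have hq0 : 0 < q := by positivity
  have hq1 : q < 1 := Real.rpow_lt_one_of_one_lt_of_neg (by norm_num) (by linarith)
  -- The caps `|κ - σ| < 2 * 2⁻ⁿ`, weighted by `2 ^ p * 2 ^ (n p)`, the maximum of the kernel on
  -- `|κ - σ| ≥ 2 ^ (-(n + 1))`: their sum dominates the kernel.
  let cap : Vel → ℕ → Set Sph := fun κ n => {σ : Sph | ‖κ - σ‖ < 2 * (2 : ℝ) ^ (-(n : ℝ))}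
  refine ⟨surfaceMeasure Set.univ + ∑' n : ℕ, ENNReal.ofReal (2 ^ p * (4 * C) * q ^ n), ?_,
    fun u hu => ?_⟩
  · refine ENNReal.add_ne_top.2 ⟨measure_ne_top _ _, ?_⟩
    exact ((summable_geometric_of_lt_one hq0.le hq1).mul_left _).tsum_ofReal_ne_top
  set κ : Vel := ‖u‖⁻¹ • u with hκ
  have hκ1 : ‖κ‖ = 1 := by
    rw [hκ, norm_smul, norm_inv, norm_norm, inv_mul_cancel₀ (norm_ne_zero_iff.2 hu)]
  have hcapm : ∀ n, MeasurableSet (cap κ n) := fun n =>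
    (isOpen_lt (by fun_prop) continuous_const).measurableSet
  have hpt : ∀ σ : Sph, angularKernel p u σ ≤
      1 + ∑' n : ℕ, (cap κ n).indicator (fun _ => ENNReal.ofReal (2 ^ p * (2 : ℝ) ^ (n * p))) σ := by
    intro σ
    rw [angularKernel, ← hκ]
    set d := ‖κ - σ‖ with hd
    -- at `σ = κ` the kernel is infinite, and so is the sum
    rcases (norm_nonneg (κ - σ)).eq_or_lt with h0 | hpos
    · have : ∀ n : ℕ, (1 : ℝ≥0∞) ≤
          (cap κ n).indicator (fun _ => ENNReal.ofReal (2 ^ p * (2 : ℝ) ^ (n * p))) σ := by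
        intro n
        rw [Set.indicator_of_mem (by simp only [cap, Set.mem_ofPred_eq, ← h0]; positivity)]
        rw [ENNReal.one_le_ofReal, ← Real.rpow_add (by norm_num)]
        exact Real.one_le_rpow (by norm_num) (by positivity)
      refine le_top.trans (top_le_iff.2 ?_).ge
      rw [ENNReal.add_eq_top]
      right
      refine top_le_iff.1 (le_trans ?_ (ENNReal.tsum_le_tsum this))
      rw [ENNReal.tsum_const_eq_top_of_ne_zero one_ne_zero]
    by_cases h1 : 1 ≤ d
    · refine le_add_right ?_
      rw [ENNReal.ofReal_rpow_of_pos hpos, ENNReal.ofReal_le_one]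
      exact Real.rpow_le_one_of_one_le_of_nonpos h1 (by linarith)
    push Not at h1
    obtain ⟨n, hn1, hn2⟩ := exists_nat_pow_near_of_lt_one hpos h1.le (by norm_num : (0 : ℝ) < 1 / 2)
      (by norm_num)
    have e : (2 : ℝ) ^ (-(n : ℝ)) = (1 / 2) ^ n := by
      rw [Real.rpow_neg (by norm_num), Real.rpow_natCast]
      simp
    refine le_add_left (le_trans ?_ (ENNReal.le_tsum n))
    rw [Set.indicator_of_mem, ENNReal.ofReal_rpow_of_pos hpos]
    · apply ENNReal.ofReal_le_ofReal
      rw [← Real.rpow_add (by norm_num)]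
      have e2 : (2 : ℝ) ^ (p + n * p) = ((1 / 2 : ℝ) ^ (n + 1)) ^ (-p) := by
        rw [one_div, inv_pow, Real.inv_rpow (by positivity), Real.rpow_neg (by positivity), inv_inv,
          ← Real.rpow_natCast, ← Real.rpow_mul (by norm_num)]
        push_cast
        ring_nf
      rw [e2]
      exact Real.rpow_le_rpow_of_nonpos (by positivity) hn1.le (by linarith)
    · simp only [cap, Set.mem_ofPred_eq]
      rw [e]
      have : (0 : ℝ) < (1 / 2) ^ n := by positivity
      change d < _
      linarith
  calc _ ≤ ∫⁻ σ : Sph, (1 + ∑' n : ℕ, (cap κ n).indicator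
        (fun _ => ENNReal.ofReal (2 ^ p * (2 : ℝ) ^ (n * p))) σ) ∂surfaceMeasure :=
        lintegral_mono hpt
    _ = surfaceMeasure Set.univ + ∑' n : ℕ, ENNReal.ofReal (2 ^ p * (2 : ℝ) ^ (n * p)) *
          surfaceMeasure (cap κ n) := by
        rw [lintegral_add_left measurable_const, lintegral_one, lintegral_tsum]
        · congr 2
          ext n
          rw [lintegral_indicator_const (hcapm n)]
        · exact fun n => (measurable_const.indicator (hcapm n)).aemeasurable
    _ ≤ _ := by
        gcongr with n
        have e : (2 : ℝ) ^ (-(n : ℝ)) ≤ 1 := Real.rpow_le_one_of_one_le_of_nonpos (by norm_num) (by simp)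
        have := hcap ⟨κ, by simp [hκ1]⟩ (2 * (2 : ℝ) ^ (-(n : ℝ))) (by positivity) (by linarith)
        refine (mul_le_mul_right this _).trans ?_
        rw [← ENNReal.ofReal_mul (by positivity)]
        apply ENNReal.ofReal_le_ofReal
        have e3 : q ^ n = (2 : ℝ) ^ (n * p) * ((2 : ℝ) ^ (-(n : ℝ))) ^ 2 := by
          rw [hq, ← Real.rpow_natCast, ← Real.rpow_mul (by norm_num), ← Real.rpow_natCast (_ ^ _) 2,
            ← Real.rpow_mul (by norm_num), ← Real.rpow_add (by norm_num)]
          congr 1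
          push_cast
          ring
        rw [e3]
        exact le_of_eq (by ring)

/-! ### The change of variables along the collision path -/

/-- The point at time `t` of the segment that joins the relative velocity `z` to
`(z + |z| σ) / 2`, the relative velocity `v' - v_*`. -/
noncomputable def collisionPath (t : ℝ) (σ z : Vel) : Vel := (1 - t / 2) • z + (t / 2 * ‖z‖) • σ

theorem continuous_collisionPath :
    Continuous fun x : ℝ × Vel × Vel => collisionPath x.1 x.2.1 x.2.2 := by
  unfold collisionPath
  fun_prop

theorem norm_collisionPath_sq (t : ℝ) {σ : Vel} (hσ : ‖σ‖ = 1) (z : Vel) :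
    ‖collisionPath t σ z‖ ^ 2 = (1 - t / 2) ^ 2 * ‖z‖ ^ 2 + (t / 2 * ‖z‖) ^ 2 +
      2 * (1 - t / 2) * (t / 2 * ‖z‖) * inner ℝ z σ := by
  rw [collisionPath, norm_add_sq_real, norm_smul, norm_smul, hσ, inner_smul_left, inner_smul_right,
    Real.norm_eq_abs, Real.norm_eq_abs, mul_pow, sq_abs, mul_one, sq_abs]
  simp only [conj_trivial]
  ring

theorem half_norm_le_norm_collisionPath {t : ℝ} (ht0 : 0 ≤ t) (ht1 : t ≤ 1) {σ : Vel}
    (hσ : ‖σ‖ = 1) {z : Vel} (hz : 0 ≤ inner ℝ z σ) : ‖z‖ / 2 ≤ ‖collisionPath t σ z‖ := by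
  refine le_of_sq_le_sq ?_ (norm_nonneg _)
  rw [norm_collisionPath_sq t hσ]
  have h1 : 0 ≤ 2 * (1 - t / 2) * (t / 2 * ‖z‖) * inner ℝ z σ := by
    have : 0 ≤ 1 - t / 2 := by linarith
    positivity
  have h2 : (1 / 2) ^ 2 * ‖z‖ ^ 2 ≤ (1 - t / 2) ^ 2 * ‖z‖ ^ 2 := by
    gcongr
    linarith
  nlinarith [sq_nonneg (t / 2 * ‖z‖)]

/-- On the half space of deviation angles below `π / 2`, radial and axial increments of opposite
sign are controlled by the increment orthogonal to the axis. -/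
theorem sq_norm_sub_norm_le {σ z₁ z₂ : Vel} (hσ : ‖σ‖ = 1) (h₁ : 0 ≤ inner ℝ z₁ σ)
    (h₁₂ : inner ℝ z₁ σ ≤ inner ℝ z₂ σ) (hn : ‖z₂‖ ≤ ‖z₁‖) :
    (‖z₁‖ - ‖z₂‖) ^ 2 ≤ ‖z₁ - z₂‖ ^ 2 - inner ℝ (z₁ - z₂) σ ^ 2 := by
  set x₁ := inner ℝ z₁ σ with hx₁
  set x₂ := inner ℝ z₂ σ with hx₂
  set P₁ := ‖z₁ - x₁ • σ‖ with hP₁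
  set P₂ := ‖z₂ - x₂ • σ‖ with hP₂
  have e : ∀ z : Vel, ‖z - inner ℝ z σ • σ‖ ^ 2 = ‖z‖ ^ 2 - inner ℝ z σ ^ 2 := by
    intro z
    rw [norm_sub_sq_real, norm_smul, hσ, inner_smul_right, Real.norm_eq_abs, mul_one, sq_abs]
    ring
  have e₁ : P₁ ^ 2 = ‖z₁‖ ^ 2 - x₁ ^ 2 := e z₁
  have e₂ : P₂ ^ 2 = ‖z₂‖ ^ 2 - x₂ ^ 2 := e z₂
  have hc : inner ℝ z₁ z₂ - x₁ * x₂ ≤ P₁ * P₂ := by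
    refine le_trans (le_of_eq ?_) (real_inner_le_norm (z₁ - x₁ • σ) (z₂ - x₂ • σ))
    rw [inner_sub_left, inner_sub_right, inner_sub_right, inner_smul_left, inner_smul_left,
      inner_smul_right, inner_smul_right, real_inner_self_eq_norm_sq, hσ, real_inner_comm z₂ σ,
      ← hx₁, ← hx₂]
    simp only [conj_trivial]
    ring
  have hP0 : 0 ≤ P₁ := norm_nonneg _
  have hP0' : 0 ≤ P₂ := norm_nonneg _
  have hle₁ : P₁ ≤ ‖z₁‖ := le_of_sq_le_sq (by nlinarith [sq_nonneg x₁]) (norm_nonneg _)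
  have hle₂ : P₂ ≤ ‖z₂‖ := le_of_sq_le_sq (by nlinarith [sq_nonneg x₂]) (norm_nonneg _)
  have hPP : P₂ ≤ P₁ := by
    refine le_of_sq_le_sq ?_ hP0
    nlinarith [norm_nonneg z₂]
  have hd : ‖z₁‖ - ‖z₂‖ ≤ P₁ - P₂ := by
    by_contra hcon
    push Not at hcon
    have h1 : (‖z₁‖ - ‖z₂‖) * (‖z₁‖ + ‖z₂‖) ≤ (P₁ - P₂) * (P₁ + P₂) := by nlinarith
    have h2 : (P₁ - P₂) * (P₁ + P₂) ≤ (P₁ - P₂) * (‖z₁‖ + ‖z₂‖) :=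
      mul_le_mul_of_nonneg_left (by linarith) (by linarith)
    have h3 : 0 < ‖z₁‖ + ‖z₂‖ := by linarith [norm_nonneg z₂]
    nlinarith
  rw [norm_sub_sq_real, inner_sub_left, ← hx₁, ← hx₂]
  have : (‖z₁‖ - ‖z₂‖) ^ 2 ≤ (P₁ - P₂) ^ 2 := pow_le_pow_left₀ (by linarith) hd 2
  nlinarith

theorem norm_sub_le_collisionPath {t : ℝ} (ht0 : 0 ≤ t) (ht1 : t ≤ 1) {σ z₁ z₂ : Vel}
    (hσ : ‖σ‖ = 1) (h₁ : 0 ≤ inner ℝ z₁ σ) (h₂ : 0 ≤ inner ℝ z₂ σ) :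
    ‖z₁ - z₂‖ ≤ 6 * ‖collisionPath t σ z₁ - collisionPath t σ z₂‖ := by
  wlog hn : ‖z₂‖ ≤ ‖z₁‖ generalizing z₁ z₂
  · rw [norm_sub_rev z₁, norm_sub_rev (collisionPath t σ z₁)]
    exact this h₂ h₁ (le_of_not_ge hn)
  set N := ‖z₁‖ - ‖z₂‖ with hN
  set y := inner ℝ (z₁ - z₂) σ with hy
  set a := 1 - t / 2 with ha
  set c := t / 2 with hc
  have e : collisionPath t σ z₁ - collisionPath t σ z₂ = a • (z₁ - z₂) + (c * N) • σ := by
    rw [collisionPath, collisionPath, hN]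
    module
  have e2 : ‖collisionPath t σ z₁ - collisionPath t σ z₂‖ ^ 2 =
      a ^ 2 * ‖z₁ - z₂‖ ^ 2 + 2 * a * c * N * y + c ^ 2 * N ^ 2 := by
    rw [e, norm_add_sq_real, norm_smul, norm_smul, hσ, inner_smul_left, inner_smul_right,
      Real.norm_eq_abs, Real.norm_eq_abs, mul_pow, sq_abs, mul_one, sq_abs, ← hy]
    simp only [conj_trivial]
    ring
  have hN0 : 0 ≤ N := sub_nonneg.2 hn
  have ha1 : 1 / 2 ≤ a := by linarith
  have hc0 : 0 ≤ c := by linarith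
  have hc1 : c ≤ 1 / 2 := by linarith
  have ha2 : (1 / 2) ^ 2 ≤ a ^ 2 := pow_le_pow_left₀ (by norm_num) ha1 2
  refine le_of_sq_le_sq ?_ (by positivity)
  rw [mul_pow, e2]
  by_cases hy0 : 0 ≤ y
  · have : 0 ≤ 2 * a * c * N * y := by positivity
    nlinarith [sq_nonneg ‖z₁ - z₂‖, sq_nonneg (c * N)]
  push Not at hy0
  have hD : N ^ 2 ≤ ‖z₁ - z₂‖ ^ 2 - y ^ 2 := by
    refine sq_norm_sub_norm_le hσ h₁ ?_ hn
    rw [hy, inner_sub_left] at hy0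
    linarith
  -- the quadratic form `(a y + c N)² + a² N²` is bounded below by `(N² + y²) / 36`
  have key : N ^ 2 + y ^ 2 ≤ 36 * ((a * y + c * N) ^ 2 + a ^ 2 * N ^ 2) := by
    have h1 : y ^ 2 ≤ 4 * (a * y) ^ 2 := by nlinarith [sq_nonneg y]
    have h2 : (a * y) ^ 2 ≤ 2 * (a * y + c * N) ^ 2 + 2 * (c * N) ^ 2 := by
      nlinarith [sq_nonneg (a * y + 2 * (c * N))]
    have h3 : (c * N) ^ 2 ≤ a ^ 2 * N ^ 2 := by
      rw [mul_pow]
      gcongr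
      linarith
    have h4 : (1 / 2) ^ 2 * N ^ 2 ≤ a ^ 2 * N ^ 2 := by gcongr
    nlinarith [sq_nonneg (a * y + c * N)]
  have hrest : (1 / 2) ^ 2 * (‖z₁ - z₂‖ ^ 2 - y ^ 2 - N ^ 2) ≤
      a ^ 2 * (‖z₁ - z₂‖ ^ 2 - y ^ 2 - N ^ 2) :=
    mul_le_mul_of_nonneg_right ha2 (by linarith)
  nlinarith

open scoped NNReal in
/-- An expanding map on a set pushes Lebesgue measure forward to at most a multiple of itself. -/
theorem setLIntegral_comp_le_of_norm_sub_le {K : ℝ≥0} {f : Vel → Vel} {S : Set Vel}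
    (hf : Measurable f)
    (hK : ∀ x ∈ S, ∀ y ∈ S, ‖x - y‖ ≤ K * ‖f x - f y‖) {g : Vel → ℝ≥0∞} (hg : Measurable g) :
    ∫⁻ x in S, g (f x) ≤ (K : ℝ≥0∞) ^ (3 : ℝ) * ∫⁻ x, g x := by
  have hle : (volume.restrict S).map f ≤ (K : ℝ≥0∞) ^ (3 : ℝ) • (volume : Measure Vel) := by
    refine Measure.le_iff.2 fun E hE => ?_
    rw [Measure.map_apply hf hE, Measure.restrict_apply (hf hE)]
    have hanti : AntilipschitzWith K fun x : S => f x :=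
      AntilipschitzWith.of_le_mul_dist fun x y => by
        simpa only [Subtype.dist_eq, dist_eq_norm] using hK x x.2 y y.2
    have h1 := hanti.hausdorffMeasure_preimage_le (d := ((3 : ℕ) : ℝ)) (by norm_num) E
    have h2 : Measure.hausdorffMeasure ((3 : ℕ) : ℝ) (f ⁻¹' E ∩ S) =
        Measure.hausdorffMeasure ((3 : ℕ) : ℝ) ((fun x : S => f x) ⁻¹' E) := by
      rw [← Isometry.hausdorffMeasure_image (f := fun x : S => (x : Vel)) isometry_subtype_coe
        (Or.inl (by norm_num))]
      congr 1
      ext x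
      simp [and_comm]
    have hH : (Measure.hausdorffMeasure ((3 : ℕ) : ℝ) : Measure Vel).IsAddHaarMeasure := by
      simpa using isAddHaarMeasure_hausdorffMeasure (E := Vel)
    rw [Measure.isAddLeftInvariant_eq_smul (volume : Measure Vel)
      (Measure.hausdorffMeasure ((3 : ℕ) : ℝ))]
    simp only [Measure.smul_apply, h2]
    rw [smul_comm]
    simpa only [ENNReal.smul_def, smul_eq_mul, Nat.cast_ofNat] using mul_le_mul_right h1 _
  calc ∫⁻ x in S, g (f x) = ∫⁻ y, g y ∂((volume.restrict S).map f) := (lintegral_map hg hf).symm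
    _ ≤ ∫⁻ y, g y ∂((K : ℝ≥0∞) ^ (3 : ℝ) • (volume : Measure Vel)) := lintegral_mono' hle le_rfl
    _ = _ := by rw [lintegral_smul_measure, smul_eq_mul]

theorem setLIntegral_collisionPath_le {t : ℝ} (ht0 : 0 ≤ t) (ht1 : t ≤ 1) {σ : Vel}
    (hσ : ‖σ‖ = 1) {g : Vel → ℝ≥0∞} (hg : Measurable g) :
    ∫⁻ z in {z | 0 ≤ inner ℝ z σ}, g (collisionPath t σ z) ≤ 216 * ∫⁻ z, g z := by
  have hm : Measurable (collisionPath t σ) :=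
    (continuous_collisionPath.comp (by fun_prop : Continuous fun z => (t, σ, z))).measurable
  refine (setLIntegral_comp_le_of_norm_sub_le (K := 6) hm
    (fun x hx y hy => norm_sub_le_collisionPath ht0 ht1 hσ hx hy) hg).trans_eq ?_
  congr 1
  rw [show (3 : ℝ) = ((3 : ℕ) : ℝ) by norm_num, ENNReal.rpow_natCast]
  norm_num

/-! ### The change of variables between velocities before and after a collision -/

theorem lintegral_eq_lintegral_sphere_prod {g : Vel → ℝ≥0∞} (hg : Measurable g) :
    ∫⁻ z, g z = ∫⁻ κ : Sph, ∫⁻ r : Set.Ioi (0 : ℝ), g ((r : ℝ) • (κ : Vel))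
      ∂(Measure.volumeIoiPow 2) ∂surfaceMeasure := by
  have h := (volume : Measure Vel).measurePreserving_homeomorphUnitSphereProd
  rw [finrank_euclideanSpace, Fintype.card_fin] at h
  have hm : Measurable fun x : Sph × Set.Ioi (0 : ℝ) => g ((x.2 : ℝ) • (x.1 : Vel)) := by
    fun_prop
  have h0 : ∫⁻ z, g z = ∫⁻ z : ({0}ᶜ : Set Vel), g z ∂(volume.comap Subtype.val) := by
    rw [lintegral_subtype_comap (measurableSet_singleton _).compl, restrict_compl_singleton]
  have h1 := h.lintegral_comp hm
  rw [h0]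
  have h2 : ∀ z : ({0}ᶜ : Set Vel), g z =
      g (((homeomorphUnitSphereProd Vel z).2 : ℝ) • ((homeomorphUnitSphereProd Vel z).1 : Vel)) := by
    intro z
    congr 1
    have hz : ‖(z : Vel)‖ ≠ 0 := norm_ne_zero_iff.2 z.2
    simp [smul_smul, hz]
  simp_rw [h2]
  refine h1.trans ?_
  rw [lintegral_prod _ hm.aemeasurable]
  rfl

/-- Exchanging the direction of the relative velocity with `σ` preserves `dz dσ`. -/
theorem lintegral_lintegral_swap_direction {G : Vel → Vel → ℝ≥0∞}
    (hG : Measurable (Function.uncurry G)) :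
    ∫⁻ z, ∫⁻ σ : Sph, G z σ ∂surfaceMeasure =
      ∫⁻ z, ∫⁻ σ : Sph, G (‖z‖ • (σ : Vel)) (‖z‖⁻¹ • z) ∂surfaceMeasure := by
  have hG1 : Measurable fun x : Vel × Sph => G x.1 x.2 :=
    hG.comp (by fun_prop : Measurable fun x : Vel × Sph => (x.1, (x.2 : Vel)))
  have hG2 : Measurable fun x : Vel × Sph => G (‖x.1‖ • (x.2 : Vel)) (‖x.1‖⁻¹ • x.1) :=
    hG.comp (by fun_prop :
      Measurable fun x : Vel × Sph => (‖x.1‖ • (x.2 : Vel), ‖x.1‖⁻¹ • x.1))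
  rw [lintegral_eq_lintegral_sphere_prod hG1.lintegral_prod_right',
    lintegral_eq_lintegral_sphere_prod hG2.lintegral_prod_right']
  have e : ∀ (κ : Sph) (r : Set.Ioi (0 : ℝ)) (σ : Sph),
      G (‖(r : ℝ) • (κ : Vel)‖ • (σ : Vel)) (‖(r : ℝ) • (κ : Vel)‖⁻¹ • (r : ℝ) • (κ : Vel)) =
        G ((r : ℝ) • (σ : Vel)) κ := by
    intro κ r σ
    have hr : (0 : ℝ) < r := r.2
    have : ‖(r : ℝ) • (κ : Vel)‖ = r := by
      rw [norm_smul, norm_eq_of_mem_sphere, mul_one, Real.norm_of_nonneg hr.le]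
    rw [this, smul_smul, inv_mul_cancel₀ hr.ne', one_smul]
  simp_rw [e]
  have hm : ∀ κ : Sph, Measurable fun x : Set.Ioi (0 : ℝ) × Sph => G ((x.1 : ℝ) • (κ : Vel)) x.2 :=
    fun κ => hG.comp (by fun_prop :
      Measurable fun x : Set.Ioi (0 : ℝ) × Sph => ((x.1 : ℝ) • (κ : Vel), (x.2 : Vel)))
  have hm' : ∀ κ : Sph, Measurable fun x : Set.Ioi (0 : ℝ) × Sph => G ((x.1 : ℝ) • (x.2 : Vel)) κ :=
    fun κ => hG.comp (by fun_prop :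
      Measurable fun x : Set.Ioi (0 : ℝ) × Sph => ((x.1 : ℝ) • (x.2 : Vel), (κ : Vel)))
  have hm3 : Measurable fun x : (Sph × Sph) × Set.Ioi (0 : ℝ) =>
      G ((x.2 : ℝ) • (x.1.1 : Vel)) x.1.2 :=
    hG.comp (by fun_prop : Measurable fun x : (Sph × Sph) × Set.Ioi (0 : ℝ) =>
      ((x.2 : ℝ) • (x.1.1 : Vel), (x.1.2 : Vel)))
  calc _ = ∫⁻ κ : Sph, ∫⁻ σ : Sph, ∫⁻ r : Set.Ioi (0 : ℝ), G ((r : ℝ) • (κ : Vel)) σ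
        ∂(Measure.volumeIoiPow 2) ∂surfaceMeasure ∂surfaceMeasure :=
        lintegral_congr fun κ => lintegral_lintegral_swap (hm κ).aemeasurable
    _ = ∫⁻ σ : Sph, ∫⁻ κ : Sph, ∫⁻ r : Set.Ioi (0 : ℝ), G ((r : ℝ) • (κ : Vel)) σ
        ∂(Measure.volumeIoiPow 2) ∂surfaceMeasure ∂surfaceMeasure :=
        lintegral_lintegral_swap hm3.lintegral_prod_right'.aemeasurable
    _ = _ := lintegral_congr fun κ => (lintegral_lintegral_swap (hm' κ).aemeasurable).symm

/-- The integral over `v`, `v_*` in the variables `V = (v + v_*) / 2` and `z = v - v_*`. -/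
theorem lintegral_lintegral_eq_center {F : Vel → Vel → ℝ≥0∞}
    (hF : Measurable (Function.uncurry F)) :
    ∫⁻ v, ∫⁻ vs, F v vs = ∫⁻ V, ∫⁻ z, F (V + (1 / 2 : ℝ) • z) (V - (1 / 2 : ℝ) • z) := by
  have h1 : Measurable fun x : Vel × Vel => F (x.1 + x.2) x.1 :=
    hF.comp (by fun_prop : Measurable fun x : Vel × Vel => (x.1 + x.2, x.1))
  have h2 : Measurable fun x : Vel × Vel =>
      F (x.1 + (1 / 2 : ℝ) • x.2) (x.1 - (1 / 2 : ℝ) • x.2) :=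
    hF.comp (by fun_prop : Measurable fun x : Vel × Vel =>
      (x.1 + (1 / 2 : ℝ) • x.2, x.1 - (1 / 2 : ℝ) • x.2))
  calc _ = ∫⁻ vs, ∫⁻ v, F v vs := lintegral_lintegral_swap hF.aemeasurable
    _ = ∫⁻ vs, ∫⁻ z, F (vs + z) vs :=
        lintegral_congr fun vs => (lintegral_add_left_eq_self (fun v => F v vs) vs).symm
    _ = ∫⁻ z, ∫⁻ vs, F (vs + z) vs := lintegral_lintegral_swap h1.aemeasurable
    _ = ∫⁻ z, ∫⁻ V, F (V + (1 / 2 : ℝ) • z) (V - (1 / 2 : ℝ) • z) := by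
        refine lintegral_congr fun z => ?_
        rw [← lintegral_sub_right_eq_self (fun vs => F (vs + z) vs) ((1 / 2 : ℝ) • z)]
        refine lintegral_congr fun V => ?_
        congr 1
        module
    _ = _ := (lintegral_lintegral_swap h2.aemeasurable).symm

/-- The measure `dv dv_* dσ` is invariant under the map from the velocities before a collision to
those after it. -/
theorem lintegral_postVel {F : Vel → Vel → Vel → ℝ≥0∞}
    (hF : Measurable fun x : Vel × Vel × Vel => F x.1 x.2.1 x.2.2) :
    ∫⁻ v, ∫⁻ vs, ∫⁻ σ : Sph, F v vs σ ∂surfaceMeasure =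
      ∫⁻ v, ∫⁻ vs, ∫⁻ σ : Sph, F (postVel v vs σ) (postVelStar v vs σ) (‖v - vs‖⁻¹ • (v - vs))
        ∂surfaceMeasure := by
  have h1 : Measurable fun x : (Vel × Vel) × Sph => F x.1.1 x.1.2 x.2 :=
    hF.comp (by fun_prop : Measurable fun x : (Vel × Vel) × Sph => (x.1.1, x.1.2, (x.2 : Vel)))
  have h2 : Measurable fun x : (Vel × Vel) × Sph => F (postVel x.1.1 x.1.2 x.2)
      (postVelStar x.1.1 x.1.2 x.2) (‖x.1.1 - x.1.2‖⁻¹ • (x.1.1 - x.1.2)) :=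
    hF.comp (by unfold postVel postVelStar; fun_prop : Measurable fun x : (Vel × Vel) × Sph =>
      (postVel x.1.1 x.1.2 x.2, postVelStar x.1.1 x.1.2 x.2,
        ‖x.1.1 - x.1.2‖⁻¹ • (x.1.1 - x.1.2)))
  rw [lintegral_lintegral_eq_center (F := fun v vs => ∫⁻ σ : Sph, F v vs σ ∂surfaceMeasure)
      h1.lintegral_prod_right',
    lintegral_lintegral_eq_center (F := fun v vs => ∫⁻ σ : Sph, F (postVel v vs σ)
      (postVelStar v vs σ) (‖v - vs‖⁻¹ • (v - vs)) ∂surfaceMeasure) h2.lintegral_prod_right']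
  refine lintegral_congr fun V => ?_
  have h3 : Measurable (Function.uncurry fun z σ : Vel =>
      F (V + (1 / 2 : ℝ) • z) (V - (1 / 2 : ℝ) • z) σ) :=
    hF.comp (by fun_prop : Measurable fun x : Vel × Vel =>
      (V + (1 / 2 : ℝ) • x.1, V - (1 / 2 : ℝ) • x.1, x.2))
  refine (lintegral_lintegral_swap_direction h3).trans ?_
  refine lintegral_congr fun z => lintegral_congr fun σ => ?_
  have e1 : V + (1 / 2 : ℝ) • z - (V - (1 / 2 : ℝ) • z) = z := by module
  have e2 : V + (1 / 2 : ℝ) • z + (V - (1 / 2 : ℝ) • z) = (2 : ℝ) • V := by module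
  simp only [postVel, postVelStar, e1, e2]
  congr 1 <;> module

/-! ### The collision kernel along the collision path -/

theorem norm_normalize_sub_sq {z σ : Vel} (hz : z ≠ 0) (hσ : ‖σ‖ = 1) :
    ‖‖z‖⁻¹ • z - σ‖ ^ 2 = 2 - 2 * (inner ℝ z σ / ‖z‖) := by
  have hz' : ‖z‖ ≠ 0 := norm_ne_zero_iff.2 hz
  rw [norm_sub_sq_real, norm_smul, norm_inv, norm_norm, inv_mul_cancel₀ hz', hσ, inner_smul_left]
  simp only [conj_trivial]
  field_simp
  ring

theorem inner_collisionPath (t : ℝ) {σ : Vel} (hσ : ‖σ‖ = 1) (z : Vel) :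
    inner ℝ (collisionPath t σ z) σ = (1 - t / 2) * inner ℝ z σ + t / 2 * ‖z‖ := by
  rw [collisionPath, inner_add_left, inner_smul_left, inner_smul_left, real_inner_self_eq_norm_sq,
    hσ]
  simp only [conj_trivial]
  ring

/-- The relative velocity turns towards `σ` along the collision path, so that the singularity of
the angular kernel only gets worse. -/
theorem angularKernel_le_collisionPath {p : ℝ} (hp : 0 ≤ p) {t : ℝ} (ht0 : 0 ≤ t) (ht1 : t ≤ 1)
    {σ z : Vel} (hσ : ‖σ‖ = 1) (hz : 0 ≤ inner ℝ z σ) (hz0 : z ≠ 0) :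
    angularKernel p z σ ≤ angularKernel p (collisionPath t σ z) σ := by
  have hzn : 0 < ‖z‖ := norm_pos_iff.2 hz0
  have hun : 0 < ‖collisionPath t σ z‖ := by
    linarith [half_norm_le_norm_collisionPath ht0 ht1 hσ hz]
  have hun1 : ‖collisionPath t σ z‖ ≤ ‖z‖ := by
    refine (norm_add_le _ _).trans_eq ?_
    rw [norm_smul, norm_smul, hσ, Real.norm_of_nonneg (by linarith),
      Real.norm_of_nonneg (by positivity)]
    ring
  have hzσ : inner ℝ z σ ≤ ‖z‖ := by
    simpa [hσ] using real_inner_le_norm z σ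
  rw [angularKernel, angularKernel, ENNReal.rpow_neg, ENNReal.rpow_neg, ENNReal.inv_le_inv]
  refine ENNReal.rpow_le_rpow (ENNReal.ofReal_le_ofReal ?_) hp
  refine le_of_sq_le_sq ?_ (norm_nonneg _)
  rw [norm_normalize_sub_sq hz0 hσ, norm_normalize_sub_sq (norm_pos_iff.1 hun) hσ,
    inner_collisionPath t hσ]
  have : inner ℝ z σ / ‖z‖ ≤ ((1 - t / 2) * inner ℝ z σ + t / 2 * ‖z‖) / ‖collisionPath t σ z‖ := by
    have h1 : inner ℝ z σ ≤ (1 - t / 2) * inner ℝ z σ + t / 2 * ‖z‖ := by nlinarith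
    exact div_le_div₀ (hz.trans h1) h1 hun hun1
  linarith

theorem enorm_angular_mul_le {s c : ℝ} (hs : 0 < s) (hc : 0 < c) {b : ℝ → ℝ}
    (hb : IsAngularFunction s c b) {z : Vel} (hz0 : z ≠ 0) (σ : Sph) (hz : 0 ≤ inner ℝ z (σ : Vel)) :
    ‖b (cosDeviation z σ)‖ₑ * ENNReal.ofReal (‖‖z‖⁻¹ • z - σ‖ / 2) ≤
      ENNReal.ofReal (1 / c) * angularKernel (1 + 2 * s) z σ := by
  have hσ : ‖(σ : Vel)‖ = 1 := norm_eq_of_mem_sphere σ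
  have hzn : 0 < ‖z‖ := norm_pos_iff.2 hz0
  set d := ‖‖z‖⁻¹ • z - σ‖ with hd
  have hd2 := norm_normalize_sub_sq hz0 hσ
  rw [← hd] at hd2
  have hx : cosDeviation z σ = inner ℝ z (σ : Vel) / ‖z‖ := by
    rw [cosDeviation, inner_smul_left]
    simp only [conj_trivial]
    field_simp
  rw [← hx] at hd2
  set x := cosDeviation z σ
  have hx0 : 0 ≤ x := hx ▸ div_nonneg hz hzn.le
  have hd0 : 0 ≤ d := norm_nonneg _
  -- at deviation angle zero `b` is not controlled, but the second factor vanishes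
  rcases hd0.eq_or_lt with h0 | hpos
  · simp [← h0]
  have hx1 : x < 1 := by nlinarith
  set θ := Real.arccos x with hθ
  have hcos : Real.cos θ = x := Real.cos_arccos (by linarith) hx1.le
  have hθ0 : 0 < θ := Real.arccos_pos.2 hx1
  have hθ1 : θ ≤ Real.pi / 2 := Real.arccos_le_pi_div_two.2 hx0
  have hsin : d / 2 ≤ Real.sin θ := by
    rw [hθ, Real.sin_arccos]
    refine Real.le_sqrt_of_sq_le ?_
    nlinarith
  have hdθ : d ≤ θ := by
    refine le_of_sq_le_sq ?_ hθ0.le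
    have := Real.one_sub_sq_div_two_le_cos (x := θ)
    rw [hcos] at this
    linarith
  have hl := hb.lower θ hθ0 hθ1
  have hu := hb.upper θ hθ0 hθ1
  rw [hcos] at hl hu
  have hb0 : 0 ≤ b x := by
    have h1 : 0 ≤ Real.sin θ * b x := le_trans (by positivity) hl
    exact nonneg_of_mul_nonneg_right h1 (lt_of_lt_of_le (by positivity) hsin)
  rw [angularKernel, ← hd, ENNReal.ofReal_rpow_of_pos hpos, Real.enorm_of_nonneg hb0,
    ← ENNReal.ofReal_mul hb0, ← ENNReal.ofReal_mul (by positivity)]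
  apply ENNReal.ofReal_le_ofReal
  calc b x * (d / 2) ≤ Real.sin θ * b x := by rw [mul_comm]; gcongr
    _ ≤ 1 / (c * θ ^ (1 + 2 * s)) := hu
    _ ≤ 1 / (c * d ^ (1 + 2 * s)) := by gcongr
    _ = 1 / c * d ^ (-(1 + 2 * s)) := by
      rw [Real.rpow_neg hpos.le, one_div, one_div, mul_inv]

theorem enorm_sub_collisionPath_le {H : Vel → ℝ} (hH : ContDiff ℝ 1 H) {z σ : Vel} (hz0 : z ≠ 0) :
    ‖H (collisionPath 1 σ z) - H z‖ₑ ≤ ENNReal.ofReal (‖z‖ * (‖‖z‖⁻¹ • z - σ‖ / 2)) *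
      ∫⁻ t in Set.Icc (0 : ℝ) 1, ‖fderiv ℝ H (collisionPath t σ z)‖ₑ := by
  have hzn : ‖z‖ ≠ 0 := norm_ne_zero_iff.2 hz0
  set w : Vel := (-(‖z‖ / 2)) • (‖z‖⁻¹ • z - σ) with hw
  have hpath : ∀ t : ℝ, collisionPath t σ z = z + t • w := by
    intro t
    have : w = (-(1 / 2) : ℝ) • z + (‖z‖ / 2) • σ := by
      rw [hw, smul_sub, smul_smul]
      have : -(‖z‖ / 2) * ‖z‖⁻¹ = -(1 / 2) := by field_simp
      rw [this]
      module
    rw [collisionPath, this]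
    module
  have hwn : ‖w‖ₑ = ENNReal.ofReal (‖z‖ * (‖‖z‖⁻¹ • z - σ‖ / 2)) := by
    rw [← ofReal_norm, hw, norm_smul, norm_neg, Real.norm_of_nonneg (by positivity)]
    congr 1
    ring
  have hφ : ContDiff ℝ 1 fun t : ℝ => H (z + t • w) := by fun_prop
  have hder : ∀ t : ℝ, deriv (fun t : ℝ => H (z + t • w)) t = fderiv ℝ H (z + t • w) w := by
    intro t
    have h1 : HasDerivAt (fun t : ℝ => z + t • w) w t := by
      simpa using ((hasDerivAt_id t).smul_const w).const_add z
    have h2 := (hH.differentiable one_ne_zero (z + t • w)).hasFDerivAt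
    exact (h2.comp_hasDerivAt t h1).deriv
  have := enorm_sub_le_lintegral_deriv_of_contDiffOn_Icc (hφ.contDiffOn (s := Set.Icc 0 1))
    zero_le_one
  simp only [one_smul, zero_smul, add_zero, hder] at this
  simp only [hpath, one_smul]
  refine this.trans ?_
  rw [← hwn, ← lintegral_const_mul' _ _ (enorm_ne_top)]
  refine lintegral_mono fun t => ?_
  rw [mul_comm]
  exact ContinuousLinearMap.le_opENorm _ _

/-- The majorant of the integrand of the collision integral of `H(v' - v_*) - H(v - v_*)`, as a
function of a point `u` of the collision path. Its weight is `W (2 |u|)` because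
`|v - v_*| ≤ 2 |u|`. -/
noncomputable def pathDensity (γ s : ℝ) (W : ℝ → ℝ≥0∞) (H : Vel → ℝ) (σ u : Vel) : ℝ≥0∞ :=
  angularKernel (1 + 2 * s) u σ *
    (W (2 * ‖u‖) * ENNReal.ofReal (‖u‖ ^ (γ + 1)) * ‖fderiv ℝ H u‖ₑ)

theorem enorm_kernel_mul_sub_le {γ s c : ℝ} (hγ : 0 < γ) (hs : 0 < s) (hc : 0 < c) {b : ℝ → ℝ}
    (hb : IsAngularFunction s c b) {W : ℝ → ℝ≥0∞} {H : Vel → ℝ} (hW : Monotone W)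
    (hH : ContDiff ℝ 1 H) {z : Vel} (hz0 : z ≠ 0) (σ : Sph) (hz : 0 ≤ inner ℝ z (σ : Vel)) :
    ‖hardPotentialKernel γ b z σ‖ₑ * ‖H (collisionPath 1 σ z) - H z‖ₑ * W ‖z‖ ≤
      ENNReal.ofReal (2 ^ (γ + 1)) * ENNReal.ofReal (1 / c) *
        ∫⁻ t in Set.Icc (0 : ℝ) 1, pathDensity γ s W H σ (collisionPath t σ z) := by
  set K : ℝ≥0∞ := ENNReal.ofReal (2 ^ (γ + 1)) * ENNReal.ofReal (1 / c) with hK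
  have hK' : K ≠ ⊤ := ENNReal.mul_ne_top ENNReal.ofReal_ne_top ENNReal.ofReal_ne_top
  have hσ : ‖(σ : Vel)‖ = 1 := norm_eq_of_mem_sphere σ
  have hzn : 0 < ‖z‖ := norm_pos_iff.2 hz0
  have h1 := enorm_sub_collisionPath_le (σ := (σ : Vel)) hH hz0
  have h2 := enorm_angular_mul_le hs hc hb hz0 σ hz
  set d := ‖‖z‖⁻¹ • z - σ‖
  have hker : ‖hardPotentialKernel γ b z σ‖ₑ * ENNReal.ofReal (‖z‖ * (d / 2)) ≤
      ENNReal.ofReal (1 / c) * ENNReal.ofReal (‖z‖ ^ (γ + 1)) *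
        angularKernel (1 + 2 * s) z σ := by
    rw [hardPotentialKernel, enorm_mul, Real.enorm_of_nonneg (by positivity),
      ENNReal.ofReal_mul hzn.le, Real.rpow_add hzn, Real.rpow_one,
      ENNReal.ofReal_mul (by positivity)]
    calc _ = ENNReal.ofReal (‖z‖ ^ γ) * ENNReal.ofReal ‖z‖ *
          (‖b (cosDeviation z σ)‖ₑ * ENNReal.ofReal (d / 2)) := by ring
      _ ≤ ENNReal.ofReal (‖z‖ ^ γ) * ENNReal.ofReal ‖z‖ *
          (ENNReal.ofReal (1 / c) * angularKernel (1 + 2 * s) z σ) := by gcongr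
      _ = _ := by ring
  have hmeas : Measurable fun t : ℝ => ‖fderiv ℝ H (collisionPath t σ z)‖ₑ := by
    have := continuous_collisionPath.comp
      (by fun_prop : Continuous fun t : ℝ => (t, (σ : Vel), z))
    exact ((hH.continuous_fderiv one_ne_zero).comp this).enorm.measurable
  calc _ ≤ ‖hardPotentialKernel γ b z σ‖ₑ * (ENNReal.ofReal (‖z‖ * (d / 2)) *
        ∫⁻ t in Set.Icc (0 : ℝ) 1, ‖fderiv ℝ H (collisionPath t σ z)‖ₑ) * W ‖z‖ := by gcongr
    _ = ‖hardPotentialKernel γ b z σ‖ₑ * ENNReal.ofReal (‖z‖ * (d / 2)) * W ‖z‖ *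
        ∫⁻ t in Set.Icc (0 : ℝ) 1, ‖fderiv ℝ H (collisionPath t σ z)‖ₑ := by ring
    _ ≤ ENNReal.ofReal (1 / c) * ENNReal.ofReal (‖z‖ ^ (γ + 1)) *
        angularKernel (1 + 2 * s) z σ * W ‖z‖ *
        ∫⁻ t in Set.Icc (0 : ℝ) 1, ‖fderiv ℝ H (collisionPath t σ z)‖ₑ := by gcongr
    _ = ∫⁻ t in Set.Icc (0 : ℝ) 1, ENNReal.ofReal (1 / c) * ENNReal.ofReal (‖z‖ ^ (γ + 1)) *
        angularKernel (1 + 2 * s) z σ * W ‖z‖ * ‖fderiv ℝ H (collisionPath t σ z)‖ₑ :=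
        (lintegral_const_mul _ hmeas).symm
    _ ≤ ∫⁻ t in Set.Icc (0 : ℝ) 1, K * pathDensity γ s W H σ (collisionPath t σ z) := by
        refine setLIntegral_mono' measurableSet_Icc fun t ht => ?_
        have e1 := half_norm_le_norm_collisionPath ht.1 ht.2 hσ hz
        have e2 : ‖z‖ ≤ 2 * ‖collisionPath t σ z‖ := by linarith
        have e3 : ENNReal.ofReal (‖z‖ ^ (γ + 1)) ≤ ENNReal.ofReal (2 ^ (γ + 1)) *
            ENNReal.ofReal (‖collisionPath t σ z‖ ^ (γ + 1)) := by
          rw [← ENNReal.ofReal_mul (by positivity), ← Real.mul_rpow (by norm_num) (norm_nonneg _)]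
          gcongr
        have e4 := angularKernel_le_collisionPath (p := 1 + 2 * s) (by linarith) ht.1 ht.2 hσ
          hz hz0
        calc _ ≤ ENNReal.ofReal (1 / c) * (ENNReal.ofReal (2 ^ (γ + 1)) *
              ENNReal.ofReal (‖collisionPath t σ z‖ ^ (γ + 1))) *
              angularKernel (1 + 2 * s) (collisionPath t σ z) σ *
              W (2 * ‖collisionPath t σ z‖) * ‖fderiv ℝ H (collisionPath t σ z)‖ₑ := by
              gcongr
              exact hW e2
          _ = _ := by
              simp only [pathDensity, hK]
              ring
    _ = _ := lintegral_const_mul' _ _ hK'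

theorem measurable_pathDensity {γ s : ℝ} {W : ℝ → ℝ≥0∞} {H : Vel → ℝ} (hW : Monotone W)
    (hH : ContDiff ℝ 1 H) : Measurable fun x : Vel × Vel => pathDensity γ s W H x.1 x.2 := by
  have h1 : Measurable W := hW.measurable
  have h2 : Measurable fun u : Vel => ‖fderiv ℝ H u‖ₑ :=
    (hH.continuous_fderiv one_ne_zero).enorm.measurable
  have h3 : Measurable fun u : Vel =>
      W (2 * ‖u‖) * ENNReal.ofReal (‖u‖ ^ (γ + 1)) * ‖fderiv ℝ H u‖ₑ := by
    fun_prop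
  exact ((measurable_angularKernel (1 + 2 * s)).comp measurable_swap).mul (h3.comp measurable_snd)

theorem lintegral_pathDensity_le {γ s : ℝ} (hγ : 0 < γ) {W : ℝ → ℝ≥0∞} {H : Vel → ℝ} {C : ℝ≥0∞}
    (hC : ∀ u : Vel, u ≠ 0 → ∫⁻ σ : Sph, angularKernel (1 + 2 * s) u σ ∂surfaceMeasure ≤ C)
    (u : Vel) : ∫⁻ σ : Sph, pathDensity γ s W H σ u ∂surfaceMeasure ≤
      C * (W (2 * ‖u‖) * ENNReal.ofReal (‖u‖ ^ (γ + 1)) * ‖fderiv ℝ H u‖ₑ) := by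
  rcases eq_or_ne u 0 with rfl | hu
  · simp [pathDensity, Real.zero_rpow (by linarith : γ + 1 ≠ 0)]
  · have hm : Measurable fun σ : Sph => angularKernel (1 + 2 * s) u σ := by
      unfold angularKernel
      fun_prop
    simp only [pathDensity]
    rw [lintegral_mul_const _ hm]
    exact mul_le_mul_left (hC u hu) _

/-- The cancellation in `H(v' - v_*) - H(v - v_*)` makes the angular singularity integrable: the
weighted collision integral of this difference is bounded by a weighted integral of `∇H`. -/
theorem exists_lintegral_kernel_mul_sub_le {γ s c : ℝ} (hγ : 0 < γ) (hs : 0 < s) (hs1 : s < 1 / 2)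
    (hc : 0 < c) {b : ℝ → ℝ} (hb : IsAngularFunction s c b) :
    ∃ C : ℝ≥0∞, C ≠ ⊤ ∧ ∀ (W : ℝ → ℝ≥0∞) (H : Vel → ℝ), Monotone W → ContDiff ℝ 1 H →
      ∫⁻ z, ∫⁻ σ : Sph, ‖hardPotentialKernel γ b z σ‖ₑ * ‖H (collisionPath 1 σ z) - H z‖ₑ * W ‖z‖
        ∂surfaceMeasure ≤
      C * ∫⁻ u, W (2 * ‖u‖) * ENNReal.ofReal (‖u‖ ^ (γ + 1)) * ‖fderiv ℝ H u‖ₑ := by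
  obtain ⟨C₀, hC₀, hang⟩ := exists_lintegral_angularKernel_le (p := 1 + 2 * s) (by linarith)
    (by linarith)
  set K : ℝ≥0∞ := ENNReal.ofReal (2 ^ (γ + 1)) * ENNReal.ofReal (1 / c) with hK
  have hK' : K ≠ ⊤ := ENNReal.mul_ne_top ENNReal.ofReal_ne_top ENNReal.ofReal_ne_top
  refine ⟨K * 216 * C₀, ENNReal.mul_ne_top (ENNReal.mul_ne_top hK' (by norm_num)) hC₀,
    fun W H hW hH => ?_⟩
  -- a fresh name, so that unification does not unfold the density
  obtain ⟨g, hgd⟩ : ∃ g : Vel → Vel → ℝ≥0∞, g = pathDensity γ s W H := ⟨_, rfl⟩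
  have hg : Measurable fun x : Vel × Vel => g x.1 x.2 := hgd ▸ measurable_pathDensity hW hH
  let S : Set (Sph × Vel) := {x | 0 ≤ inner ℝ x.2 (x.1 : Vel)}
  have hS : MeasurableSet S := measurableSet_le measurable_const
    (measurable_snd.inner (measurable_subtype_coe.comp measurable_fst))
  have hgp : Measurable fun x : (Sph × Vel) × ℝ => g x.1.1 (collisionPath x.2 x.1.1 x.1.2) := by
    have h1 : Measurable fun x : (Sph × Vel) × ℝ => collisionPath x.2 x.1.1 x.1.2 :=
      (continuous_collisionPath.comp
        (by fun_prop : Continuous fun x : (Sph × Vel) × ℝ => (x.2, (x.1.1 : Vel), x.1.2))).measurable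
    have h2 : Measurable fun x : (Sph × Vel) × ℝ =>
        ((x.1.1 : Vel), collisionPath x.2 x.1.1 x.1.2) :=
      Measurable.prodMk (measurable_subtype_coe.comp (measurable_fst.comp measurable_fst)) h1
    exact hg.comp h2
  let G : Sph → Vel → ℝ≥0∞ := fun σ z =>
    S.indicator (fun x => ∫⁻ t in Set.Icc (0 : ℝ) 1, g x.1 (collisionPath t x.1 x.2)) (σ, z)
  have hG : Measurable (Function.uncurry G) := (hgp.lintegral_prod_right').indicator hS
  have hpt : ∀ (z : Vel) (σ : Sph),
      ‖hardPotentialKernel γ b z σ‖ₑ * ‖H (collisionPath 1 σ z) - H z‖ₑ * W ‖z‖ ≤ K * G σ z := by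
    intro z σ
    rcases eq_or_ne z 0 with rfl | hz0
    · -- the direction of `z = 0` is meaningless, but `|z|^γ` vanishes
      simp [hardPotentialKernel, Real.zero_rpow hγ.ne']
    have hzn : 0 < ‖z‖ := norm_pos_iff.2 hz0
    by_cases hz : 0 ≤ inner ℝ z (σ : Vel)
    swap
    · have : cosDeviation z σ < 0 := by
        rw [cosDeviation, inner_smul_left]
        simp only [conj_trivial]
        exact mul_neg_of_pos_of_neg (by positivity) (not_le.1 hz)
      simp [hardPotentialKernel, hb.eq_zero_of_neg _ this]
    have hGe : G σ z = ∫⁻ t in Set.Icc (0 : ℝ) 1, g σ (collisionPath t σ z) :=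
      Set.indicator_of_mem (show (σ, z) ∈ S from hz) _
    rw [hGe, hgd]
    exact enorm_kernel_mul_sub_le hγ hs hc hb hW hH hz0 σ hz
  have hslice : ∀ σ : Sph, ∫⁻ z, G σ z ≤ 216 * ∫⁻ u, g σ u := by
    intro σ
    have hσ : ‖(σ : Vel)‖ = 1 := norm_eq_of_mem_sphere σ
    have hSσ : MeasurableSet {z : Vel | 0 ≤ inner ℝ z (σ : Vel)} :=
      (isClosed_le continuous_const (by fun_prop)).measurableSet
    have hm : Measurable fun x : Vel × ℝ => g σ (collisionPath x.2 σ x.1) :=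
      hgp.comp (by fun_prop : Measurable fun x : Vel × ℝ => ((σ, x.1), x.2))
    calc ∫⁻ z, G σ z = ∫⁻ z in {z : Vel | 0 ≤ inner ℝ z (σ : Vel)},
          ∫⁻ t in Set.Icc (0 : ℝ) 1, g σ (collisionPath t σ z) := by
          rw [← lintegral_indicator hSσ]
          rfl
      _ = ∫⁻ t in Set.Icc (0 : ℝ) 1, ∫⁻ z in {z : Vel | 0 ≤ inner ℝ z (σ : Vel)},
          g σ (collisionPath t σ z) := lintegral_lintegral_swap hm.aemeasurable
      _ ≤ ∫⁻ t in Set.Icc (0 : ℝ) 1, 216 * ∫⁻ u, g σ u :=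
          setLIntegral_mono' measurableSet_Icc fun t ht =>
            setLIntegral_collisionPath_le ht.1 ht.2 hσ (hg.comp measurable_prodMk_left)
      _ = _ := by simp
  have hgs : Measurable (Function.uncurry fun (σ : Sph) u => g σ u) :=
    hg.comp (by fun_prop : Measurable fun x : Sph × Vel => ((x.1 : Vel), x.2))
  calc _ ≤ ∫⁻ z, ∫⁻ σ : Sph, K * G σ z ∂surfaceMeasure :=
        lintegral_mono fun z => lintegral_mono fun σ => hpt z σ
    _ = ∫⁻ σ : Sph, (∫⁻ z, K * G σ z) ∂surfaceMeasure :=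
        lintegral_lintegral_swap (f := fun z σ => K * G σ z)
          ((hG.const_mul K).comp measurable_swap).aemeasurable
    _ ≤ ∫⁻ σ : Sph, K * (216 * ∫⁻ u, g σ u) ∂surfaceMeasure := by
        refine lintegral_mono fun σ => ?_
        rw [lintegral_const_mul' _ _ hK']
        gcongr
        exact hslice σ
    _ = K * 216 * ∫⁻ u, ∫⁻ σ : Sph, g σ u ∂surfaceMeasure := by
        simp only [← mul_assoc]
        rw [lintegral_const_mul' _ _ (ENNReal.mul_ne_top hK' (by norm_num)),
          lintegral_lintegral_swap hgs.aemeasurable]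
    _ ≤ K * 216 * ∫⁻ u, C₀ *
          (W (2 * ‖u‖) * ENNReal.ofReal (‖u‖ ^ (γ + 1)) * ‖fderiv ℝ H u‖ₑ) := by
        gcongr with u
        rw [hgd]
        exact lintegral_pathDensity_le hγ hang u
    _ = _ := by
        rw [lintegral_const_mul' _ _ hC₀]
        ring

/-! ### The collision operator on smooth functions -/

theorem weightedLpNorm_one (w h : Vel → ℝ) (hw : ∀ v, 0 ≤ w v) :
    weightedLpNorm 1 w h = ∫⁻ v, ‖h v‖ₑ * ENNReal.ofReal (w v) := by
  rw [weightedLpNorm, eLpNorm_one_eq_lintegral_enorm]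
  refine lintegral_congr fun v => ?_
  rw [enorm_mul, Real.enorm_of_nonneg (hw v)]

theorem weightedLpNorm_one_polyWeight (q : ℝ) (h : Vel → ℝ) :
    weightedLpNorm 1 (polyWeight q) h = ∫⁻ v, ‖h v‖ₑ * ENNReal.ofReal (polyWeight q v) :=
  weightedLpNorm_one _ _ fun v => (polyWeight_pos q v).le

theorem weight_mul_le {k a : ℝ} (hk : 0 ≤ k) (ha : 0 ≤ a) {x y : Vel} {r : ℝ} (hr0 : 0 ≤ r)
    (hr : r ≤ ‖x‖ + ‖y‖) : (bracket x + 2 * r) ^ k * r ^ a ≤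
      5 ^ k * 2 ^ a * (polyWeight (k + a) x * polyWeight (k + a) y) := by
  have hx := one_le_bracket x
  have hy := one_le_bracket y
  have hr' : r ≤ bracket x + bracket y := by linarith [norm_le_bracket x, norm_le_bracket y]
  have h1 : r ≤ 2 * (bracket x * bracket y) := by nlinarith
  have h2 : bracket x + 2 * r ≤ 5 * (bracket x * bracket y) := by nlinarith
  have hxy : 0 < bracket x * bracket y := by positivity
  calc _ ≤ (5 * (bracket x * bracket y)) ^ k * (2 * (bracket x * bracket y)) ^ a := by gcongr
    _ = 5 ^ k * 2 ^ a * ((bracket x * bracket y) ^ k * (bracket x * bracket y) ^ a) := by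
      rw [Real.mul_rpow (by norm_num) hxy.le, Real.mul_rpow (by norm_num) hxy.le]
      ring
    _ = _ := by
      rw [← Real.rpow_add hxy, Real.mul_rpow (by linarith) (by linarith), polyWeight, polyWeight]

theorem lintegral_add_smul_eq_self {ε : ℝ} (hε : ε = 1 ∨ ε = -1) (g : Vel → ℝ≥0∞) (x : Vel) :
    ∫⁻ u, g (x + ε • u) = ∫⁻ u, g u := by
  rcases hε with rfl | rfl
  · simpa using lintegral_add_left_eq_self g x
  · simpa [sub_eq_add_neg] using lintegral_sub_left_eq_self g x

/-- The collision integral of a difference of the values of `f` before and after a collision, in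
one argument, against the value at the unchanged argument `x`. The two signs `ε` are those of
`v = x + z` and of `v_* = x - z`. -/
theorem exists_lintegral_mul_kernel_mul_sub_le {γ s c : ℝ} (hγ : 0 < γ) (hs : 0 < s)
    (hs1 : s < 1 / 2) (hc : 0 < c) {b : ℝ → ℝ} (hb : IsAngularFunction s c b) {k : ℝ}
    (hk : 0 ≤ k) : ∃ C : ℝ≥0∞, C ≠ ⊤ ∧ ∀ (f : Vel → ℝ) (ε : ℝ), ContDiff ℝ 1 f → (ε = 1 ∨ ε = -1) →
      ∫⁻ x, ‖f x‖ₑ * ∫⁻ z, ∫⁻ σ : Sph, ‖hardPotentialKernel γ b z σ‖ₑ *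
        ‖f (x + ε • collisionPath 1 σ z) - f (x + ε • z)‖ₑ * ENNReal.ofReal ((bracket x + ‖z‖) ^ k)
          ∂surfaceMeasure ≤
      C * (weightedLpNorm 1 (polyWeight (k + (γ + 1))) f *
        weightedLpNorm 1 (polyWeight (k + (γ + 1))) fun v => ‖fderiv ℝ f v‖) := by
  obtain ⟨C₁, hC₁, hcore⟩ := exists_lintegral_kernel_mul_sub_le hγ hs hs1 hc hb
  set A : ℝ≥0∞ := ENNReal.ofReal (5 ^ k * 2 ^ (γ + 1)) with hA
  have hA' : A ≠ ⊤ := ENNReal.ofReal_ne_top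
  refine ⟨C₁ * A, ENNReal.mul_ne_top hC₁ hA', fun f ε hf hε => ?_⟩
  set q := k + (γ + 1) with hq
  set N : ℝ≥0∞ := weightedLpNorm 1 (polyWeight q) fun v => ‖fderiv ℝ f v‖ with hN
  have hNe : N = ∫⁻ y, ‖fderiv ℝ f y‖ₑ * ENNReal.ofReal (polyWeight q y) := by
    rw [hN, weightedLpNorm_one_polyWeight]
    simp only [enorm_norm]
  have habs : ∀ u : Vel, ‖ε • u‖ = ‖u‖ := by
    intro u
    rcases hε with rfl | rfl <;> simp
  have hder : ∀ x u : Vel, ‖fderiv ℝ (fun u => f (x + ε • u)) u‖ₑ = ‖fderiv ℝ f (x + ε • u)‖ₑ := by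
    intro x u
    have h1 : HasFDerivAt (fun u : Vel => x + ε • u) (ε • ContinuousLinearMap.id ℝ Vel) u :=
      ((hasFDerivAt_id u).const_smul ε).const_add x
    have h2 := (hf.differentiable one_ne_zero (x + ε • u)).hasFDerivAt
    have h3 : fderiv ℝ (fun u => f (x + ε • u)) u = _ := (h2.comp u h1).fderiv
    rw [h3]
    rcases hε with rfl | rfl <;> simp
  have hx : ∀ x : Vel, ∫⁻ z, ∫⁻ σ : Sph, ‖hardPotentialKernel γ b z σ‖ₑ *
      ‖f (x + ε • collisionPath 1 σ z) - f (x + ε • z)‖ₑ * ENNReal.ofReal ((bracket x + ‖z‖) ^ k)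
        ∂surfaceMeasure ≤ C₁ * A * N * ENNReal.ofReal (polyWeight q x) := by
    intro x
    have hbx := bracket_pos x
    have hW : Monotone fun r : ℝ => ENNReal.ofReal ((bracket x + max r 0) ^ k) := by
      intro r₁ r₂ hr
      have : 0 ≤ max r₁ 0 := le_max_right _ _
      dsimp only
      gcongr
    have h := hcore _ (fun u => f (x + ε • u)) hW (by fun_prop)
    simp only [max_eq_left (norm_nonneg _), hder,
      max_eq_left (mul_nonneg zero_le_two (norm_nonneg _))] at h
    refine h.trans ?_
    have hpt : ∀ u : Vel, ENNReal.ofReal ((bracket x + 2 * ‖u‖) ^ k) *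
        ENNReal.ofReal (‖u‖ ^ (γ + 1)) * ‖fderiv ℝ f (x + ε • u)‖ₑ ≤
        A * ENNReal.ofReal (polyWeight q x) *
          (‖fderiv ℝ f (x + ε • u)‖ₑ * ENNReal.ofReal (polyWeight q (x + ε • u))) := by
      intro u
      have hu : ‖u‖ ≤ ‖x‖ + ‖x + ε • u‖ := by
        rw [← habs u, add_comm]
        simpa using norm_sub_le (x + ε • u) x
      have := ENNReal.ofReal_le_ofReal
        (weight_mul_le hk (by linarith : 0 ≤ γ + 1) (norm_nonneg u) hu)
      rw [ENNReal.ofReal_mul (by positivity), ENNReal.ofReal_mul (by positivity),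
        ENNReal.ofReal_mul (polyWeight_pos _ _).le] at this
      calc _ ≤ A * (ENNReal.ofReal (polyWeight q x) * ENNReal.ofReal (polyWeight q (x + ε • u))) *
            ‖fderiv ℝ f (x + ε • u)‖ₑ := by gcongr
        _ = _ := by ring
    calc _ ≤ C₁ * ∫⁻ u, A * ENNReal.ofReal (polyWeight q x) *
          (‖fderiv ℝ f (x + ε • u)‖ₑ * ENNReal.ofReal (polyWeight q (x + ε • u))) :=
          mul_le_mul_right (lintegral_mono hpt) _
      _ = C₁ * A * N * ENNReal.ofReal (polyWeight q x) := by
          rw [lintegral_const_mul' _ _ (ENNReal.mul_ne_top hA' ENNReal.ofReal_ne_top),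
            lintegral_add_smul_eq_self hε
              (fun y => ‖fderiv ℝ f y‖ₑ * ENNReal.ofReal (polyWeight q y)), ← hNe]
          ring
  calc _ ≤ ∫⁻ x, C₁ * A * N * (‖f x‖ₑ * ENNReal.ofReal (polyWeight q x)) := by
        refine lintegral_mono fun x => ?_
        refine (mul_le_mul_right (hx x) _).trans_eq ?_
        ring
    _ = _ := by
        have hm : Measurable fun x => ‖f x‖ₑ * ENNReal.ofReal (polyWeight q x) :=
          hf.continuous.enorm.measurable.mul (continuous_polyWeight q).measurable.ennreal_ofReal
        rw [lintegral_const_mul _ hm, ← weightedLpNorm_one_polyWeight]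
        ring

theorem polyWeight_le_of_norm_sub_le {k : ℝ} (hk : 0 ≤ k) {x v : Vel} {r : ℝ}
    (h : ‖v - x‖ ≤ r) : polyWeight k v ≤ (bracket x + r) ^ k := by
  have := bracket_le_add_norm_sub v x
  exact Real.rpow_le_rpow (bracket_pos v).le (by linarith) hk

theorem postVel_add_self (x z : Vel) (σ : Sph) :
    postVel (x + z) x σ = x + (1 : ℝ) • collisionPath 1 σ z := by
  rw [postVel, collisionPath, add_sub_cancel_left]
  module

theorem postVelStar_self_sub (x z : Vel) (σ : Sph) :
    postVelStar x (x - z) σ = x + (-1 : ℝ) • collisionPath 1 σ z := by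
  rw [postVelStar, collisionPath, sub_sub_cancel]
  module

theorem norm_postVel_sub_le (v vs : Vel) (σ : Sph) : ‖postVel v vs σ - v‖ ≤ ‖v - vs‖ := by
  have e : postVel v vs σ - v = (‖v - vs‖ / 2) • (σ : Vel) - (1 / 2 : ℝ) • (v - vs) := by
    rw [postVel]
    module
  rw [e]
  refine (norm_sub_le _ _).trans_eq ?_
  rw [norm_smul, norm_smul, norm_eq_of_mem_sphere, Real.norm_of_nonneg (by positivity),
    Real.norm_of_nonneg (by norm_num)]
  ring

theorem measurable_hardPotentialKernel {γ s c : ℝ} {b : ℝ → ℝ} (hb : IsAngularFunction s c b) :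
    Measurable fun x : Vel × Sph => hardPotentialKernel γ b x.1 x.2 := by
  have h1 : Measurable fun x : Vel × Sph => cosDeviation x.1 x.2 := by
    unfold cosDeviation
    exact (by fun_prop : Measurable fun x : Vel × Sph => ‖x.1‖⁻¹ • x.1).inner
      (measurable_subtype_coe.comp measurable_snd)
  exact (measurable_fst.norm.pow_const γ).mul (hb.measurable.comp h1)

theorem continuous_postVel : Continuous fun x : Vel × Vel × Sph => postVel x.1 x.2.1 x.2.2 := by
  unfold postVel
  fun_prop

theorem continuous_postVelStar :
    Continuous fun x : Vel × Vel × Sph => postVelStar x.1 x.2.1 x.2.2 := by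
  unfold postVelStar
  fun_prop

/-- The collision term in which the value at `v'` is unchanged becomes, in the variables after the
collision, one in which the value at `v` is unchanged. -/
theorem lintegral_kernel_mul_postVel {γ s c : ℝ} (hγ : 0 < γ) {b : ℝ → ℝ}
    (hb : IsAngularFunction s c b) {f : Vel → ℝ} (hf : Continuous f) {w : Vel → ℝ≥0∞}
    (hw : Measurable w) :
    ∫⁻ v, ∫⁻ vs, ∫⁻ σ : Sph, ‖hardPotentialKernel γ b (v - vs) σ‖ₑ * (‖f (postVel v vs σ)‖ₑ *
        ‖f (postVelStar v vs σ) - f vs‖ₑ) * w v ∂surfaceMeasure =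
      ∫⁻ v, ∫⁻ vs, ∫⁻ σ : Sph, ‖hardPotentialKernel γ b (v - vs) σ‖ₑ * (‖f v‖ₑ *
        ‖f (postVelStar v vs σ) - f vs‖ₑ) * w (postVel v vs σ) ∂surfaceMeasure := by
  -- the left-hand integrand, with `σ` extended to the whole space
  let F : Vel → Vel → Vel → ℝ≥0∞ := fun v vs τ =>
    ‖‖v - vs‖ ^ γ * b (inner ℝ (‖v - vs‖⁻¹ • (v - vs)) τ)‖ₑ *
      (‖f ((1 / 2 : ℝ) • (v + vs) + (‖v - vs‖ / 2) • τ)‖ₑ *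
        ‖f ((1 / 2 : ℝ) • (v + vs) - (‖v - vs‖ / 2) • τ) - f vs‖ₑ) * w v
  have hF : Measurable fun x : Vel × Vel × Vel => F x.1 x.2.1 x.2.2 := by
    have h1 : Measurable f := hf.measurable
    have h2 : Measurable b := hb.measurable
    simp only [F]
    fun_prop
  refine (lintegral_postVel hF).trans ?_
  refine lintegral_congr fun v => lintegral_congr fun vs => lintegral_congr fun σ => ?_
  have e1 : postVel v vs σ - postVelStar v vs σ = ‖v - vs‖ • (σ : Vel) := by
    rw [postVel, postVelStar]
    module
  have e2 : postVel v vs σ + postVelStar v vs σ = v + vs := by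
    rw [postVel, postVelStar]
    module
  have e3 : ‖postVel v vs σ - postVelStar v vs σ‖ = ‖v - vs‖ := by
    rw [e1, norm_smul, norm_eq_of_mem_sphere, mul_one, norm_norm]
  simp only [F, e2, e3]
  rcases eq_or_ne v vs with rfl | hne
  · simp [hardPotentialKernel, Real.zero_rpow hγ.ne']
  have hn : ‖v - vs‖ ≠ 0 := norm_ne_zero_iff.2 (sub_ne_zero.2 hne)
  have e4 : (‖v - vs‖ / 2) • ‖v - vs‖⁻¹ • (v - vs) = (1 / 2 : ℝ) • (v - vs) := by
    rw [smul_smul]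
    congr 1
    field_simp
  have e5 : inner ℝ (‖v - vs‖⁻¹ • (postVel v vs σ - postVelStar v vs σ))
      (‖v - vs‖⁻¹ • (v - vs)) = cosDeviation (v - vs) σ := by
    rw [e1, smul_smul, inv_mul_cancel₀ hn, one_smul, real_inner_comm, cosDeviation]
  have e6 : (1 / 2 : ℝ) • (v + vs) + (1 / 2 : ℝ) • (v - vs) = v := by module
  have e7 : (1 / 2 : ℝ) • (v + vs) - (1 / 2 : ℝ) • (v - vs) = vs := by module
  rw [e4, e5, e6, e7, ← enorm_neg (f vs - _), neg_sub, hardPotentialKernel]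

theorem lintegral_triple_add {F₁ F₂ : Vel → Vel → Sph → ℝ≥0∞}
    (h : Measurable fun x : Vel × Vel × Sph => F₁ x.1 x.2.1 x.2.2) :
    ∫⁻ v, ∫⁻ vs, ∫⁻ σ : Sph, (F₁ v vs σ + F₂ v vs σ) ∂surfaceMeasure =
      (∫⁻ v, ∫⁻ vs, ∫⁻ σ : Sph, F₁ v vs σ ∂surfaceMeasure) +
        ∫⁻ v, ∫⁻ vs, ∫⁻ σ : Sph, F₂ v vs σ ∂surfaceMeasure := by
  have h' : Measurable fun x : (Vel × Vel) × Sph => F₁ x.1.1 x.1.2 x.2 :=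
    h.comp (by fun_prop : Measurable fun x : (Vel × Vel) × Sph => (x.1.1, x.1.2, x.2))
  rw [← lintegral_add_left h'.lintegral_prod_right'.lintegral_prod_right']
  refine lintegral_congr fun v => ?_
  have h2 : Measurable fun vs => ∫⁻ σ : Sph, F₁ v vs σ ∂surfaceMeasure :=
    h'.lintegral_prod_right'.comp measurable_prodMk_left
  refine Eq.trans ?_ (lintegral_add_left h2 _)
  refine lintegral_congr fun vs => ?_
  exact lintegral_add_left (h.comp (by fun_prop : Measurable fun σ : Sph => (v, vs, σ))) _

theorem measurable_kernel_mul_postVel {γ s c : ℝ} {b : ℝ → ℝ} (hb : IsAngularFunction s c b)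
    {f : Vel → ℝ} (hf : Continuous f) {w : Vel → ℝ≥0∞} (hw : Measurable w) :
    Measurable fun x : Vel × Vel × Sph => ‖hardPotentialKernel γ b (x.1 - x.2.1) x.2.2‖ₑ *
      (‖f x.2.1‖ₑ * ‖f (postVel x.1 x.2.1 x.2.2) - f x.1‖ₑ) * w x.1 := by
  have h1 : Measurable fun x : Vel × Vel × Sph => hardPotentialKernel γ b (x.1 - x.2.1) x.2.2 :=
    Measurable.comp (g := fun x : Vel × Sph => hardPotentialKernel γ b x.1 x.2)
      (f := fun x : Vel × Vel × Sph => (x.1 - x.2.1, x.2.2)) (measurable_hardPotentialKernel hb)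
      (by fun_prop)
  have h2 : Measurable fun x : Vel × Vel × Sph => f (postVel x.1 x.2.1 x.2.2) :=
    (hf.comp continuous_postVel).measurable
  have h3 : Measurable f := hf.measurable
  have h4 : Measurable fun x : Vel × Vel × Sph => f x.2.1 :=
    h3.comp (measurable_fst.comp measurable_snd)
  have h5 : Measurable fun x : Vel × Vel × Sph => f x.1 := h3.comp measurable_fst
  have h6 : Measurable fun x : Vel × Vel × Sph => w x.1 := hw.comp measurable_fst
  exact (h1.enorm.mul (h4.enorm.mul (h2.sub h5).enorm)).mul h6

theorem lintegral_kernel_mul_postVel_sub_le {γ s c : ℝ} {b : ℝ → ℝ} (hb : IsAngularFunction s c b)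
    {k : ℝ} (hk : 0 ≤ k) {f : Vel → ℝ} (hf : Continuous f) :
    ∫⁻ v, ∫⁻ vs, ∫⁻ σ : Sph, ‖hardPotentialKernel γ b (v - vs) σ‖ₑ *
        (‖f vs‖ₑ * ‖f (postVel v vs σ) - f v‖ₑ) * ENNReal.ofReal (polyWeight k v)
          ∂surfaceMeasure ≤
      ∫⁻ x, ‖f x‖ₑ * ∫⁻ z, ∫⁻ σ : Sph, ‖hardPotentialKernel γ b z σ‖ₑ *
        ‖f (x + (1 : ℝ) • collisionPath 1 σ z) - f (x + (1 : ℝ) • z)‖ₑ *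
          ENNReal.ofReal ((bracket x + ‖z‖) ^ k) ∂surfaceMeasure := by
  have hm : Measurable fun x : (Vel × Vel) × Sph =>
      ‖hardPotentialKernel γ b (x.1.1 - x.1.2) x.2‖ₑ *
        (‖f x.1.2‖ₑ * ‖f (postVel x.1.1 x.1.2 x.2) - f x.1.1‖ₑ) *
          ENNReal.ofReal (polyWeight k x.1.1) := by
    have h := (measurable_kernel_mul_postVel (γ := γ) hb hf
      (continuous_polyWeight k).measurable.ennreal_ofReal).comp
        (by fun_prop : Measurable fun x : (Vel × Vel) × Sph => (x.1.1, x.1.2, x.2))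
    exact h
  rw [lintegral_lintegral_swap (f := fun v vs => ∫⁻ σ : Sph,
    ‖hardPotentialKernel γ b (v - vs) σ‖ₑ * (‖f vs‖ₑ * ‖f (postVel v vs σ) - f v‖ₑ) *
      ENNReal.ofReal (polyWeight k v) ∂surfaceMeasure) hm.lintegral_prod_right'.aemeasurable]
  refine lintegral_mono fun x => ?_
  rw [← lintegral_add_left_eq_self _ x]
  simp_rw [← lintegral_const_mul' _ _ (enorm_ne_top (x := f x))]
  refine lintegral_mono fun z => lintegral_mono fun σ => ?_
  simp only [postVel_add_self, add_sub_cancel_left, one_smul]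
  have hw := ENNReal.ofReal_le_ofReal
    (polyWeight_le_of_norm_sub_le hk (by simp : ‖x + z - x‖ ≤ ‖z‖))
  calc _ = ‖f x‖ₑ * (‖hardPotentialKernel γ b z σ‖ₑ *
        ‖f (x + collisionPath 1 σ z) - f (x + z)‖ₑ * ENNReal.ofReal (polyWeight k (x + z))) := by
        ring
    _ ≤ _ := by gcongr

theorem lintegral_kernel_mul_postVelStar_sub_le {γ s c : ℝ} (hγ : 0 < γ) {b : ℝ → ℝ}
    (hb : IsAngularFunction s c b) {k : ℝ} (hk : 0 ≤ k) {f : Vel → ℝ} (hf : Continuous f) :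
    ∫⁻ v, ∫⁻ vs, ∫⁻ σ : Sph, ‖hardPotentialKernel γ b (v - vs) σ‖ₑ * (‖f (postVel v vs σ)‖ₑ *
        ‖f (postVelStar v vs σ) - f vs‖ₑ) * ENNReal.ofReal (polyWeight k v) ∂surfaceMeasure ≤
      ∫⁻ x, ‖f x‖ₑ * ∫⁻ z, ∫⁻ σ : Sph, ‖hardPotentialKernel γ b z σ‖ₑ *
        ‖f (x + (-1 : ℝ) • collisionPath 1 σ z) - f (x + (-1 : ℝ) • z)‖ₑ *
          ENNReal.ofReal ((bracket x + ‖z‖) ^ k) ∂surfaceMeasure := by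
  rw [lintegral_kernel_mul_postVel hγ hb hf (continuous_polyWeight k).measurable.ennreal_ofReal]
  refine lintegral_mono fun x => ?_
  rw [← lintegral_sub_left_eq_self _ x]
  simp_rw [← lintegral_const_mul' _ _ (enorm_ne_top (x := f x))]
  refine lintegral_mono fun z => lintegral_mono fun σ => ?_
  have hz := norm_postVel_sub_le x (x - z) σ
  simp only [sub_sub_cancel] at hz
  have hw := ENNReal.ofReal_le_ofReal (polyWeight_le_of_norm_sub_le hk hz)
  have e : x + (-1 : ℝ) • z = x - z := by module
  simp only [postVelStar_self_sub, sub_sub_cancel, e]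
  calc _ = ‖f x‖ₑ * (‖hardPotentialKernel γ b z σ‖ₑ *
        ‖f (x + (-1 : ℝ) • collisionPath 1 σ z) - f (x - z)‖ₑ *
          ENNReal.ofReal (polyWeight k (postVel x (x - z) σ))) := by
        ring
    _ ≤ _ := by gcongr

/-- The `L¹(⟨v⟩^k)` norm of the collision operator, with the absolute value inside the collision
integral, on continuously differentiable functions. -/
theorem exists_lintegral_collisionIntegrand_le {γ s c : ℝ} (hγ : 0 < γ) (hs : 0 < s)
    (hs1 : s < 1 / 2) (hc : 0 < c) {b : ℝ → ℝ} (hb : IsAngularFunction s c b) {k : ℝ}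
    (hk : 0 ≤ k) : ∃ C : ℝ≥0∞, C ≠ ⊤ ∧ ∀ f : Vel → ℝ, ContDiff ℝ 1 f →
      ∫⁻ v, ∫⁻ vs, ∫⁻ σ : Sph, ‖collisionIntegrand (hardPotentialKernel γ b) f f v (vs, σ)‖ₑ *
        ENNReal.ofReal (polyWeight k v) ∂surfaceMeasure ≤
      C * (weightedLpNorm 1 (polyWeight (k + (γ + 1))) f *
        weightedLpNorm 1 (polyWeight (k + (γ + 1))) fun v => ‖fderiv ℝ f v‖) := by
  obtain ⟨C, hC, hJ⟩ := exists_lintegral_mul_kernel_mul_sub_le hγ hs hs1 hc hb hk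
  refine ⟨C + C, ENNReal.add_ne_top.2 ⟨hC, hC⟩, fun f hf => ?_⟩
  rw [add_mul]
  refine le_trans ?_ (add_le_add
    ((lintegral_kernel_mul_postVel_sub_le hb hk hf.continuous).trans (hJ f 1 hf (Or.inl rfl)))
    ((lintegral_kernel_mul_postVelStar_sub_le hγ hb hk hf.continuous).trans
      (hJ f (-1) hf (Or.inr rfl))))
  rw [← lintegral_triple_add (measurable_kernel_mul_postVel hb hf.continuous
    (continuous_polyWeight k).measurable.ennreal_ofReal)]
  refine lintegral_mono fun v => lintegral_mono fun vs => lintegral_mono fun σ => ?_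
  simp only [← add_mul, ← mul_add, collisionIntegrand, enorm_mul]
  gcongr
  have e : f (postVelStar v vs σ) * f (postVel v vs σ) - f vs * f v =
      f vs * (f (postVel v vs σ) - f v) + f (postVel v vs σ) * (f (postVelStar v vs σ) - f vs) := by
    ring
  rw [e, ← enorm_mul, ← enorm_mul]
  exact enorm_add_le _ _

/-! ### Interpolation of weighted integrals -/

/-- If `X` is bounded by `δ⁻¹ A + δ³ B` at every scale `δ`, it is bounded by the value of this
expression, up to a factor, at the optimal scale `(A / B) ^ (1 / 4)`. -/
theorem le_mul_rpow_of_forall_scale {X C A B : ℝ≥0∞} (hC : C ≠ ⊤) (hA : A ≠ ⊤) (hB : B ≠ ⊤)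
    (h : ∀ δ : ℝ, 0 < δ → X ≤ C * (ENNReal.ofReal δ⁻¹ * A + ENNReal.ofReal (δ ^ 3) * B)) :
    X ≤ C * 2 * (A ^ (3 / 4 : ℝ) * B ^ (1 / 4 : ℝ)) := by
  lift A to NNReal using hA
  lift B to NNReal using hB
  -- `A` and `B` are enlarged by `ε` because either may vanish
  have hε : ∀ ε : ℝ, 0 < ε →
      X ≤ C * ENNReal.ofReal (2 * (((A : ℝ) + ε) ^ (3 / 4 : ℝ) * ((B : ℝ) + ε) ^ (1 / 4 : ℝ))) := by
    intro ε hε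
    set a : ℝ := ((A : ℝ) + ε) ^ (1 / 4 : ℝ) with ha
    set b : ℝ := ((B : ℝ) + ε) ^ (1 / 4 : ℝ) with hb
    have hA0 : 0 < (A : ℝ) + ε := by positivity
    have hB0 : 0 < (B : ℝ) + ε := by positivity
    have ha0 : 0 < a := Real.rpow_pos_of_pos hA0 _
    have hb0 : 0 < b := Real.rpow_pos_of_pos hB0 _
    have ha4 : a ^ 4 = (A : ℝ) + ε := by
      rw [ha, ← Real.rpow_natCast, ← Real.rpow_mul hA0.le]
      norm_num
    have hb4 : b ^ 4 = (B : ℝ) + ε := by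
      rw [hb, ← Real.rpow_natCast, ← Real.rpow_mul hB0.le]
      norm_num
    have ha3 : ((A : ℝ) + ε) ^ (3 / 4 : ℝ) = a ^ 3 := by
      rw [ha, ← Real.rpow_natCast, ← Real.rpow_mul hA0.le]
      norm_num
    refine (h (a / b) (by positivity)).trans ?_
    gcongr
    rw [← ENNReal.ofReal_coe_nnreal (p := A), ← ENNReal.ofReal_coe_nnreal (p := B),
      ← ENNReal.ofReal_mul (by positivity), ← ENNReal.ofReal_mul (by positivity),
      ← ENNReal.ofReal_add (by positivity) (by positivity)]
    apply ENNReal.ofReal_le_ofReal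
    rw [ha3]
    have h1 : (a / b)⁻¹ * (A : ℝ) ≤ (a / b)⁻¹ * a ^ 4 := by
      gcongr
      linarith
    have h2 : (a / b) ^ 3 * (B : ℝ) ≤ (a / b) ^ 3 * b ^ 4 := by
      gcongr
      linarith
    have h3 : (a / b)⁻¹ * a ^ 4 = a ^ 3 * b := by field_simp
    have h4 : (a / b) ^ 3 * b ^ 4 = a ^ 3 * b := by field_simp
    linarith
  have hlim : Filter.Tendsto (fun ε : ℝ => C * ENNReal.ofReal
      (2 * (((A : ℝ) + ε) ^ (3 / 4 : ℝ) * ((B : ℝ) + ε) ^ (1 / 4 : ℝ)))) (nhdsWithin 0 (Set.Ioi 0))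
      (nhds (C * ENNReal.ofReal
        (2 * (((A : ℝ) + 0) ^ (3 / 4 : ℝ) * ((B : ℝ) + 0) ^ (1 / 4 : ℝ))))) := by
    refine ENNReal.Tendsto.const_mul ?_ (Or.inr hC)
    refine ENNReal.tendsto_ofReal (Filter.Tendsto.mono_left ?_ nhdsWithin_le_nhds)
    refine Filter.Tendsto.const_mul _ (Filter.Tendsto.mul ?_ ?_)
    · exact (Filter.Tendsto.const_add _ Filter.tendsto_id).rpow_const (Or.inr (by norm_num))
    · exact (Filter.Tendsto.const_add _ Filter.tendsto_id).rpow_const (Or.inr (by norm_num))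
  refine (ge_of_tendsto hlim (Filter.eventually_of_mem self_mem_nhdsWithin hε)).trans_eq ?_
  rw [add_zero, add_zero, ENNReal.ofReal_mul (by norm_num), ENNReal.ofReal_mul (by positivity),
    ← ENNReal.ofReal_rpow_of_nonneg A.coe_nonneg (by norm_num),
    ← ENNReal.ofReal_rpow_of_nonneg B.coe_nonneg (by norm_num), ENNReal.ofReal_coe_nnreal,
    ENNReal.ofReal_coe_nnreal, ENNReal.ofReal_ofNat, mul_assoc]

theorem weightedLpNorm_one_interpolate {f : Vel → ℝ} (hf : Continuous f) (k a : ℝ) :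
    weightedLpNorm 1 (polyWeight (k + a)) f ≤
      weightedLpNorm 1 (polyWeight k) f ^ (3 / 4 : ℝ) *
        weightedLpNorm 1 (polyWeight (k + 4 * a)) f ^ (1 / 4 : ℝ) := by
  have hm : ∀ q, Measurable fun v => ‖f v‖ₑ * ENNReal.ofReal (polyWeight q v) := fun q =>
    hf.enorm.measurable.mul (continuous_polyWeight q).measurable.ennreal_ofReal
  simp only [weightedLpNorm_one_polyWeight]
  refine le_trans (le_of_eq ?_) (ENNReal.lintegral_mul_norm_pow_le (hm k).aemeasurable
    (hm (k + 4 * a)).aemeasurable (by norm_num) (by norm_num) (by norm_num))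
  refine lintegral_congr fun v => ?_
  have hb := bracket_pos v
  rw [ENNReal.mul_rpow_of_nonneg _ _ (by norm_num), ENNReal.mul_rpow_of_nonneg _ _ (by norm_num),
    ENNReal.ofReal_rpow_of_nonneg (polyWeight_pos _ _).le (by norm_num),
    ENNReal.ofReal_rpow_of_nonneg (polyWeight_pos _ _).le (by norm_num), mul_mul_mul_comm,
    ← ENNReal.rpow_add_of_nonneg _ _ (by norm_num) (by norm_num),
    ← ENNReal.ofReal_mul (by have := polyWeight_pos k v; positivity), polyWeight, polyWeight,
    polyWeight, ← Real.rpow_mul hb.le, ← Real.rpow_mul hb.le, ← Real.rpow_add hb]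
  norm_num
  congr 3
  ring

/-! ### Interpolation of the gradient -/

theorem taylor_cubic_remainder_le {φ : ℝ → ℝ} (hφ : ContDiff ℝ 4 φ) {x : ℝ} (hx : 0 < x) :
    |φ x - (φ 0 + deriv φ 0 * x + iteratedDeriv 2 φ 0 * (x ^ 2 / 2) +
      iteratedDeriv 3 φ 0 * (x ^ 3 / 6))| ≤
      x ^ 3 / 6 * ∫ t in (0 : ℝ)..x, |iteratedDeriv 4 φ t| := by
  have hu : Set.uIcc 0 x = Set.Icc 0 x := Set.uIcc_of_le hx.le
  have hud : UniqueDiffOn ℝ (Set.Icc 0 x) := uniqueDiffOn_Icc hx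
  have hw : ∀ n : ℕ, n ≤ 4 → ∀ t ∈ Set.Icc 0 x,
      iteratedDerivWithin n φ (Set.Icc 0 x) t = iteratedDeriv n φ t := fun n hn t ht =>
    iteratedDerivWithin_eq_iteratedDeriv hud (hφ.of_le (by exact_mod_cast hn)).contDiffAt ht
  have h0 : (0 : ℝ) ∈ Set.Icc 0 x := ⟨le_rfl, hx.le⟩
  have hT := taylor_integral_remainder (f := φ) (x := x) (x₀ := 0) (n := 3) hφ.contDiffOn
  have hP : taylorWithinEval φ 3 (Set.Icc 0 x) 0 x = φ 0 + deriv φ 0 * x +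
      iteratedDeriv 2 φ 0 * (x ^ 2 / 2) + iteratedDeriv 3 φ 0 * (x ^ 3 / 6) := by
    simp only [taylorWithinEval_succ, taylor_within_zero_eval, hw 1 (by norm_num) 0 h0,
      hw 2 (by norm_num) 0 h0, hw 3 (by norm_num) 0 h0, iteratedDeriv_one, smul_eq_mul, zero_add,
      Nat.reduceAdd]
    norm_num [Nat.factorial]
    ring
  rw [hu, hP] at hT
  rw [hT]
  have hc : Continuous fun t => |iteratedDeriv 4 φ t| :=
    (hφ.continuous_iteratedDeriv 4 le_rfl).abs
  rw [← intervalIntegral.integral_const_mul]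
  refine (Real.norm_eq_abs _).symm.trans_le ?_
  refine intervalIntegral.norm_integral_le_of_norm_le hx.le ?_
    ((hc.const_mul _).intervalIntegrable (μ := volume) _ _)
  refine Filter.Eventually.of_forall fun t ht => ?_
  rw [hw 4 le_rfl t ⟨ht.1.le, ht.2⟩, smul_eq_mul, norm_mul, Real.norm_eq_abs, Real.norm_eq_abs]
  gcongr
  have h1 : 0 ≤ x - t := by linarith [ht.2]
  rw [abs_of_nonneg (by positivity)]
  have h2 : (x - t) ^ 3 ≤ x ^ 3 := pow_le_pow_left₀ h1 (by linarith [ht.1]) 3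
  norm_num [Nat.factorial]
  linarith

/-- The one-sided four-point difference formula for the derivative, with its remainder. -/
theorem abs_deriv_le_of_four_points {φ : ℝ → ℝ} (hφ : ContDiff ℝ 4 φ) {r : ℝ} (hr : 0 < r) :
    |deriv φ 0| ≤ 3 / r * ∑ j ∈ Finset.range 4, |φ (j * r)| +
      4 * r ^ 2 * ∫ t in (0 : ℝ)..(3 * r), |iteratedDeriv 4 φ t| := by
  have hc : Continuous fun t => |iteratedDeriv 4 φ t| :=
    (hφ.continuous_iteratedDeriv 4 le_rfl).abs
  set I := ∫ t in (0 : ℝ)..(3 * r), |iteratedDeriv 4 φ t| with hI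
  have hle : ∀ x, 0 ≤ x → x ≤ 3 * r → ∫ t in (0 : ℝ)..x, |iteratedDeriv 4 φ t| ≤ I :=
    fun x hx0 hx => intervalIntegral.integral_mono_interval le_rfl hx0 hx
      (Filter.Eventually.of_forall fun t => abs_nonneg _) (hc.intervalIntegrable _ _)
  have h1 := (taylor_cubic_remainder_le hφ hr).trans
    (mul_le_mul_of_nonneg_left (hle r hr.le (by linarith)) (by positivity))
  have h2 := (taylor_cubic_remainder_le hφ (by positivity : 0 < 2 * r)).trans
    (mul_le_mul_of_nonneg_left (hle (2 * r) (by positivity) (by linarith)) (by positivity))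
  have h3 := (taylor_cubic_remainder_le hφ (by positivity : 0 < 3 * r)).trans
    (mul_le_mul_of_nonneg_left (hle (3 * r) (by positivity) le_rfl) (by positivity))
  have hmul : r * |deriv φ 0| ≤ 3 * ∑ j ∈ Finset.range 4, |φ (j * r)| + 4 * r ^ 3 * I := by
    rw [← abs_of_pos hr, ← abs_mul, abs_of_pos hr]
    simp only [Finset.sum_range_succ, Finset.sum_range_zero, Nat.cast_zero, zero_mul, zero_add,
      Nat.cast_one, one_mul, Nat.cast_ofNat]
    have a0 := neg_abs_le (φ 0)
    have a0' := le_abs_self (φ 0)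
    have a1 := neg_abs_le (φ r)
    have a1' := le_abs_self (φ r)
    have a2 := neg_abs_le (φ (2 * r))
    have a2' := le_abs_self (φ (2 * r))
    have a3 := neg_abs_le (φ (3 * r))
    have a3' := le_abs_self (φ (3 * r))
    rw [abs_le] at h1 h2 h3 ⊢
    obtain ⟨h1l, h1u⟩ := h1
    obtain ⟨h2l, h2u⟩ := h2
    obtain ⟨h3l, h3u⟩ := h3
    -- the combination with coefficients `-11/6`, `3`, `-3/2`, `1/3` cancels the terms of order
    -- two and three
    ring_nf at h1l h1u h2l h2u h3l h3u a2 a2' a3 a3' ⊢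
    constructor <;> linarith
  have e : 3 / r * ∑ j ∈ Finset.range 4, |φ (j * r)| + 4 * r ^ 2 * I =
      (3 * ∑ j ∈ Finset.range 4, |φ (j * r)| + 4 * r ^ 3 * I) / r := by
    field_simp
  rw [e, le_div_iff₀ hr, mul_comm]
  exact hmul

theorem enorm_deriv_le_of_four_points {φ : ℝ → ℝ} (hφ : ContDiff ℝ 4 φ) {r : ℝ} (hr : 0 < r) :
    ‖deriv φ 0‖ₑ ≤ ENNReal.ofReal (3 / r) * ∑ j ∈ Finset.range 4, ‖φ (j * r)‖ₑ +
      ENNReal.ofReal (4 * r ^ 2) * ∫⁻ t in Set.Ioc 0 (3 * r), ‖iteratedDeriv 4 φ t‖ₑ := by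
  have hc : Continuous fun t => |iteratedDeriv 4 φ t| :=
    (hφ.continuous_iteratedDeriv 4 le_rfl).abs
  have hI : ENNReal.ofReal (∫ t in (0 : ℝ)..(3 * r), |iteratedDeriv 4 φ t|) =
      ∫⁻ t in Set.Ioc 0 (3 * r), ‖iteratedDeriv 4 φ t‖ₑ := by
    rw [intervalIntegral.integral_of_le (by positivity), ofReal_integral_eq_lintegral_ofReal
      (hc.intervalIntegrable 0 (3 * r)).1 (Filter.Eventually.of_forall fun t => abs_nonneg _)]
    simp only [Real.enorm_eq_ofReal_abs]
  have h := ENNReal.ofReal_le_ofReal (abs_deriv_le_of_four_points hφ hr)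
  rw [ENNReal.ofReal_add, ENNReal.ofReal_mul (by positivity), ENNReal.ofReal_mul (by positivity),
    hI, ENNReal.ofReal_sum_of_nonneg fun _ _ => abs_nonneg _] at h
  · simpa only [Real.enorm_eq_ofReal_abs] using h
  · exact mul_nonneg (by positivity) (Finset.sum_nonneg fun _ _ => abs_nonneg _)
  · exact mul_nonneg (by positivity)
      (intervalIntegral.integral_nonneg (by positivity) fun _ _ => abs_nonneg _)

theorem contDiff_partialDeriv (i : Fin 3) {f : Vel → ℝ} (hf : ContDiff ℝ ∞ f) :
    ContDiff ℝ ∞ (partialDeriv i f) := by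
  unfold partialDeriv
  exact (hf.fderiv_right (m := ∞) (by simp)).clm_apply contDiff_const

theorem contDiff_iterate_partialDeriv (i : Fin 3) (n : ℕ) {f : Vel → ℝ} (hf : ContDiff ℝ ∞ f) :
    ContDiff ℝ ∞ ((partialDeriv i)^[n] f) := by
  induction n with
  | zero => exact hf
  | succ n ih =>
    rw [Function.iterate_succ_apply']
    exact contDiff_partialDeriv i ih

theorem deriv_comp_line {f : Vel → ℝ} (hf : ContDiff ℝ ∞ f) (i : Fin 3) (ε : ℝ) (v : Vel) (t : ℝ) :
    deriv (fun t : ℝ => f (v + t • ε • (EuclideanSpace.single i (1 : ℝ) : Vel))) t =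
      ε * partialDeriv i f (v + t • ε • (EuclideanSpace.single i (1 : ℝ) : Vel)) := by
  set e : Vel := EuclideanSpace.single i (1 : ℝ)
  have h1 : HasDerivAt (fun t : ℝ => v + t • ε • e) (ε • e) t := by
    simpa using ((hasDerivAt_id t).smul_const (ε • e)).const_add v
  have h2 := (hf.differentiable (by simp) (v + t • ε • e)).hasFDerivAt
  have h3 : deriv (fun t : ℝ => f (v + t • ε • e)) t = _ := (h2.comp_hasDerivAt t h1).deriv
  rw [h3, map_smul, smul_eq_mul]
  rfl

theorem iteratedDeriv_comp_line {f : Vel → ℝ} (hf : ContDiff ℝ ∞ f) (i : Fin 3) (ε : ℝ) (v : Vel)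
    (n : ℕ) :
    iteratedDeriv n (fun t : ℝ => f (v + t • ε • (EuclideanSpace.single i (1 : ℝ) : Vel))) =
      fun t => ε ^ n *
        (partialDeriv i)^[n] f (v + t • ε • (EuclideanSpace.single i (1 : ℝ) : Vel)) := by
  induction n with
  | zero => simp [iteratedDeriv_zero]
  | succ n ih =>
    rw [iteratedDeriv_succ, ih]
    funext t
    rw [deriv_const_mul_field, deriv_comp_line (contDiff_iterate_partialDeriv i n hf),
      Function.iterate_succ_apply', pow_succ]
    ring

/-- The complement of a ball is stable under outward translations of a half space. -/
theorem setLIntegral_outward_le {E : Set Vel} (hE : MeasurableSet E)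
    (hmono : ∀ v ∈ E, ∀ w : Vel, ‖v‖ ≤ ‖w‖ → w ∈ E) (e : Vel) {t : ℝ} (ht : 0 ≤ t)
    (g : Vel → ℝ≥0∞) :
    ∫⁻ v in E ∩ {v | 0 ≤ inner ℝ v e}, g (v + t • e) ≤ ∫⁻ v in E, g v := by
  have hS : MeasurableSet {v : Vel | 0 ≤ inner ℝ v e} :=
    (isClosed_le continuous_const (by fun_prop)).measurableSet
  rw [← lintegral_indicator (hE.inter hS), ← lintegral_indicator hE,
    ← lintegral_add_right_eq_self (E.indicator g) (t • e)]
  refine lintegral_mono fun v => ?_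
  by_cases hv : v ∈ E ∩ {v | 0 ≤ inner ℝ v e}
  · have hn : ‖v‖ ≤ ‖v + t • e‖ := by
      refine le_of_sq_le_sq ?_ (norm_nonneg _)
      rw [norm_add_sq_real, inner_smul_right]
      have : 0 ≤ t * inner ℝ v e := mul_nonneg ht hv.2
      nlinarith [sq_nonneg ‖t • e‖]
    rw [Set.indicator_of_mem hv, Set.indicator_of_mem (hmono v hv.1 _ hn)]
  · rw [Set.indicator_of_notMem hv]
    exact zero_le

theorem setLIntegral_half_partialDeriv_le {f : Vel → ℝ} (hf : ContDiff ℝ ∞ f) (i : Fin 3)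
    {E : Set Vel} (hE : MeasurableSet E) (hmono : ∀ v ∈ E, ∀ w : Vel, ‖v‖ ≤ ‖w‖ → w ∈ E)
    {r : ℝ} (hr : 0 < r) {ε : ℝ} (hε : ε = 1 ∨ ε = -1) :
    ∫⁻ v in E ∩ {v | 0 ≤ inner ℝ v (ε • (EuclideanSpace.single i (1 : ℝ) : Vel))},
        ‖partialDeriv i f v‖ₑ ≤
      ENNReal.ofReal (12 * r⁻¹) * (∫⁻ v in E, ‖f v‖ₑ) +
        ENNReal.ofReal (12 * r ^ 3) * ∫⁻ v in E, ‖(partialDeriv i)^[4] f v‖ₑ := by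
  set e : Vel := ε • (EuclideanSpace.single i (1 : ℝ) : Vel) with he
  set S := E ∩ {v : Vel | 0 ≤ inner ℝ v e} with hS
  have hε1 : ‖ε‖ₑ = 1 := by rcases hε with rfl | rfl <;> simp
  have hpt : ∀ v, ‖partialDeriv i f v‖ₑ ≤
      ENNReal.ofReal (3 / r) * ∑ j ∈ Finset.range 4, ‖f (v + (j * r : ℝ) • e)‖ₑ +
        ENNReal.ofReal (4 * r ^ 2) *
          ∫⁻ t in Set.Ioc 0 (3 * r), ‖(partialDeriv i)^[4] f (v + t • e)‖ₑ := by
    intro v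
    have hφ : ContDiff ℝ 4 fun t : ℝ => f (v + t • e) := by
      have : ContDiff ℝ 4 f := by exact_mod_cast contDiff_infty.1 hf 4
      fun_prop
    have h := enorm_deriv_le_of_four_points hφ hr
    rw [deriv_comp_line hf, iteratedDeriv_comp_line hf] at h
    simpa only [enorm_mul, enorm_pow, hε1, one_mul, one_pow, zero_smul, add_zero] using h
  have hg4 : Measurable fun v => ‖(partialDeriv i)^[4] f v‖ₑ :=
    (contDiff_iterate_partialDeriv i 4 hf).continuous.enorm.measurable
  have hfm : Measurable fun v => ‖f v‖ₑ := hf.continuous.enorm.measurable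
  have hjm : ∀ j : ℕ, Measurable fun v : Vel => ‖f (v + (j * r : ℝ) • e)‖ₑ := fun j =>
    hfm.comp (by fun_prop : Measurable fun v : Vel => v + (j * r : ℝ) • e)
  have hm4 : Measurable fun x : Vel × ℝ => ‖(partialDeriv i)^[4] f (x.1 + x.2 • e)‖ₑ :=
    hg4.comp (by fun_prop : Measurable fun x : Vel × ℝ => x.1 + x.2 • e)
  calc _ ≤ ∫⁻ v in S, (ENNReal.ofReal (3 / r) *
          ∑ j ∈ Finset.range 4, ‖f (v + (j * r : ℝ) • e)‖ₑ +
        ENNReal.ofReal (4 * r ^ 2) *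
          ∫⁻ t in Set.Ioc 0 (3 * r), ‖(partialDeriv i)^[4] f (v + t • e)‖ₑ) := lintegral_mono hpt
    _ = ENNReal.ofReal (3 / r) *
          ∑ j ∈ Finset.range 4, (∫⁻ v in S, ‖f (v + (j * r : ℝ) • e)‖ₑ) +
        ENNReal.ofReal (4 * r ^ 2) * ∫⁻ t in Set.Ioc 0 (3 * r),
          ∫⁻ v in S, ‖(partialDeriv i)^[4] f (v + t • e)‖ₑ := by
        rw [lintegral_add_left ((Finset.measurable_fun_sum _ fun j _ => hjm j).const_mul _),
          lintegral_const_mul' _ _ ENNReal.ofReal_ne_top,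
          lintegral_const_mul' _ _ ENNReal.ofReal_ne_top,
          lintegral_finsetSum _ fun j _ => hjm j, lintegral_lintegral_swap hm4.aemeasurable]
    _ ≤ ENNReal.ofReal (3 / r) * ∑ j ∈ Finset.range 4, (∫⁻ v in E, ‖f v‖ₑ) +
        ENNReal.ofReal (4 * r ^ 2) * ∫⁻ t in Set.Ioc 0 (3 * r),
          ∫⁻ v in E, ‖(partialDeriv i)^[4] f v‖ₑ := by
        refine add_le_add (mul_le_mul_right (Finset.sum_le_sum fun j _ => ?_) _)
          (mul_le_mul_right (setLIntegral_mono' measurableSet_Ioc fun t ht => ?_) _)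
        · exact setLIntegral_outward_le hE hmono e (by positivity) fun v => ‖f v‖ₑ
        · exact setLIntegral_outward_le hE hmono e ht.1.le fun v => ‖(partialDeriv i)^[4] f v‖ₑ
    _ = _ := by
        rw [Finset.sum_const, Finset.card_range, setLIntegral_const, Real.volume_Ioc, sub_zero,
          nsmul_eq_mul, ← mul_assoc, mul_comm (∫⁻ v in E, ‖(partialDeriv i)^[4] f v‖ₑ),
          ← mul_assoc, ← ENNReal.ofReal_mul (by positivity)]
        have e1 : ((4 : ℕ) : ℝ≥0∞) = ENNReal.ofReal 4 := by norm_num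
        rw [e1, ← ENNReal.ofReal_mul (by positivity)]
        congr 3 <;> ring

theorem setLIntegral_partialDeriv_le {f : Vel → ℝ} (hf : ContDiff ℝ ∞ f) (i : Fin 3)
    {E : Set Vel} (hE : MeasurableSet E) (hmono : ∀ v ∈ E, ∀ w : Vel, ‖v‖ ≤ ‖w‖ → w ∈ E)
    {r : ℝ} (hr : 0 < r) :
    ∫⁻ v in E, ‖partialDeriv i f v‖ₑ ≤
      24 * (ENNReal.ofReal r⁻¹ * (∫⁻ v in E, ‖f v‖ₑ) +
        ENNReal.ofReal (r ^ 3) * ∫⁻ v in E, ‖(partialDeriv i)^[4] f v‖ₑ) := by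
  have hcover : E ⊆ (E ∩ {v | 0 ≤ inner ℝ v ((1 : ℝ) • (EuclideanSpace.single i (1 : ℝ) : Vel))}) ∪
      (E ∩ {v | 0 ≤ inner ℝ v ((-1 : ℝ) • (EuclideanSpace.single i (1 : ℝ) : Vel))}) := by
    intro v hv
    rw [← Set.inter_union_distrib_left]
    refine ⟨hv, ?_⟩
    rcases le_total 0 (inner ℝ v (EuclideanSpace.single i (1 : ℝ) : Vel)) with h | h
    · left
      rwa [Set.mem_ofPred_eq, one_smul]
    · right
      rw [Set.mem_ofPred_eq, inner_smul_right]
      linarith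
  refine (lintegral_mono_set hcover).trans ((lintegral_union_le _ _ _).trans ((add_le_add
    (setLIntegral_half_partialDeriv_le hf i hE hmono hr (Or.inl rfl))
    (setLIntegral_half_partialDeriv_le hf i hE hmono hr (Or.inr rfl))).trans_eq ?_))
  rw [ENNReal.ofReal_mul (by norm_num), ENNReal.ofReal_mul (by norm_num), ENNReal.ofReal_ofNat]
  ring

/-- The complement `{2 ^ n ≤ ⟨v⟩}` of a dyadic ball. -/
def dyadicExterior (n : ℕ) : Set Vel := {v | (2 : ℝ) ^ n ≤ bracket v}

theorem measurableSet_dyadicExterior (n : ℕ) : MeasurableSet (dyadicExterior n) :=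
  (isClosed_le continuous_const continuous_bracket).measurableSet

theorem ofReal_polyWeight_le_tsum {q : ℝ} (hq : 0 ≤ q) (v : Vel) :
    ENNReal.ofReal (polyWeight q v) ≤ ENNReal.ofReal (2 ^ q) *
      ∑' n : ℕ, (dyadicExterior n).indicator (fun _ => ENNReal.ofReal (((2 : ℝ) ^ n) ^ q)) v := by
  obtain ⟨n, hn1, hn2⟩ := exists_nat_pow_near (one_le_bracket v) (by norm_num : (1 : ℝ) < 2)
  refine le_trans ?_ (mul_le_mul_right (ENNReal.le_tsum n) _)
  rw [Set.indicator_of_mem (show v ∈ dyadicExterior n from hn1),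
    ← ENNReal.ofReal_mul (by positivity), ← Real.mul_rpow (by norm_num) (by positivity)]
  apply ENNReal.ofReal_le_ofReal
  refine Real.rpow_le_rpow (bracket_pos v).le ?_ hq
  rw [mul_comm, ← pow_succ]
  exact hn2.le

theorem tsum_dyadicExterior_le {q : ℝ} (hq : 0 < q) (v : Vel) :
    ∑' n : ℕ, (dyadicExterior n).indicator (fun _ => ENNReal.ofReal (((2 : ℝ) ^ n) ^ q)) v ≤
      ENNReal.ofReal (2 ^ q / (2 ^ q - 1)) * ENNReal.ofReal (polyWeight q v) := by
  obtain ⟨N, hN1, hN2⟩ := exists_nat_pow_near (one_le_bracket v) (by norm_num : (1 : ℝ) < 2)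
  have hx : 1 < (2 : ℝ) ^ q := Real.one_lt_rpow (by norm_num) hq
  have hpow : ∀ n : ℕ, ((2 : ℝ) ^ n) ^ q = (2 ^ q) ^ n := by
    intro n
    rw [← Real.rpow_natCast, ← Real.rpow_natCast, ← Real.rpow_mul (by norm_num),
      ← Real.rpow_mul (by norm_num), mul_comm]
  rw [tsum_eq_sum (s := Finset.range (N + 1))]
  swap
  · intro n hn
    rw [Finset.mem_range, not_lt] at hn
    refine Set.indicator_of_notMem (fun hv => ?_) _
    have hv' : (2 : ℝ) ^ n ≤ bracket v := hv
    have : (2 : ℝ) ^ (N + 1) ≤ 2 ^ n := pow_le_pow_right₀ (by norm_num) hn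
    linarith
  calc _ ≤ ∑ n ∈ Finset.range (N + 1), ENNReal.ofReal (((2 : ℝ) ^ n) ^ q) :=
        Finset.sum_le_sum fun n _ => Set.indicator_le_self _ _ v
    _ = ENNReal.ofReal (∑ n ∈ Finset.range (N + 1), ((2 : ℝ) ^ q) ^ n) := by
        rw [ENNReal.ofReal_sum_of_nonneg fun n _ => by positivity]
        simp only [hpow]
    _ ≤ _ := by
        rw [← ENNReal.ofReal_mul (div_nonneg (by linarith) (by linarith))]
        apply ENNReal.ofReal_le_ofReal
        rw [geom_sum_eq hx.ne', div_mul_eq_mul_div]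
        refine div_le_div_of_nonneg_right ?_ (by linarith)
        have : ((2 : ℝ) ^ q) ^ N ≤ polyWeight q v := by
          rw [← hpow]
          exact Real.rpow_le_rpow (by positivity) hN1 hq.le
        rw [pow_succ]
        nlinarith

theorem lintegral_tsum_dyadicExterior (w : ℕ → ℝ) {g : Vel → ℝ≥0∞} (hg : Measurable g) :
    ∫⁻ v, (∑' n : ℕ, (dyadicExterior n).indicator (fun _ => ENNReal.ofReal (w n)) v) * g v =
      ∑' n : ℕ, ENNReal.ofReal (w n) * ∫⁻ v in dyadicExterior n, g v := by
  have hm : ∀ n, Measurable fun v =>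
      (dyadicExterior n).indicator (fun _ => ENNReal.ofReal (w n)) v * g v := fun n =>
    (measurable_const.indicator (measurableSet_dyadicExterior n)).mul hg
  simp only [← ENNReal.tsum_mul_right]
  rw [lintegral_tsum fun n => (hm n).aemeasurable]
  refine tsum_congr fun n => ?_
  rw [← lintegral_const_mul' _ _ ENNReal.ofReal_ne_top,
    ← lintegral_indicator (measurableSet_dyadicExterior n)]
  refine lintegral_congr fun v => ?_
  by_cases hv : v ∈ dyadicExterior n <;> simp [hv]

theorem tsum_setLIntegral_dyadicExterior_le {q : ℝ} (hq : 0 < q) {g : Vel → ℝ}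
    (hg : Continuous g) :
    ∑' n : ℕ, ENNReal.ofReal (((2 : ℝ) ^ n) ^ q) * ∫⁻ v in dyadicExterior n, ‖g v‖ₑ ≤
      ENNReal.ofReal (2 ^ q / (2 ^ q - 1)) * weightedLpNorm 1 (polyWeight q) g := by
  have hgm : Measurable fun v => ‖g v‖ₑ := hg.enorm.measurable
  calc _ = ∫⁻ v, (∑' n : ℕ, (dyadicExterior n).indicator
        (fun _ => ENNReal.ofReal (((2 : ℝ) ^ n) ^ q)) v) * ‖g v‖ₑ :=
        (lintegral_tsum_dyadicExterior _ hgm).symm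
    _ ≤ ∫⁻ v, ENNReal.ofReal (2 ^ q / (2 ^ q - 1)) *
          (‖g v‖ₑ * ENNReal.ofReal (polyWeight q v)) := by
        refine lintegral_mono fun v => ?_
        refine (mul_le_mul_left (tsum_dyadicExterior_le hq v) _).trans_eq ?_
        ring
    _ = _ := by
        rw [lintegral_const_mul' _ _ ENNReal.ofReal_ne_top, weightedLpNorm_one_polyWeight]

/-- Interpolation of a first derivative between the function and its fourth derivative in the same
direction, where each derivative gains the weight `⟨v⟩^a`. -/
theorem exists_weightedLpNorm_partialDeriv_le {k a : ℝ} (hk : 0 < k) (ha : 0 < a) :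
    ∃ C : ℝ≥0∞, C ≠ ⊤ ∧ ∀ (f : Vel → ℝ) (i : Fin 3), ContDiff ℝ ∞ f →
      weightedLpNorm 1 (polyWeight k) f ≠ ⊤ →
      weightedLpNorm 1 (polyWeight (k + 4 * a)) ((partialDeriv i)^[4] f) ≠ ⊤ →
      weightedLpNorm 1 (polyWeight (k + a)) (partialDeriv i f) ≤
        C * (weightedLpNorm 1 (polyWeight k) f ^ (3 / 4 : ℝ) *
          weightedLpNorm 1 (polyWeight (k + 4 * a)) ((partialDeriv i)^[4] f) ^ (1 / 4 : ℝ)) := by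
  let c : ℝ → ℝ≥0∞ := fun q => ENNReal.ofReal (2 ^ q / (2 ^ q - 1))
  set D : ℝ≥0∞ := ENNReal.ofReal (2 ^ (k + a)) * 24 * (c k + c (k + 4 * a)) with hD
  have hD' : D ≠ ⊤ := ENNReal.mul_ne_top (ENNReal.mul_ne_top ENNReal.ofReal_ne_top (by norm_num))
    (ENNReal.add_ne_top.2 ⟨ENNReal.ofReal_ne_top, ENNReal.ofReal_ne_top⟩)
  refine ⟨D * 2, ENNReal.mul_ne_top hD' (by norm_num), fun f i hf hA hB => ?_⟩
  refine le_mul_rpow_of_forall_scale hD' hA hB fun δ hδ => ?_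
  have hmono : ∀ n : ℕ, ∀ v ∈ dyadicExterior n, ∀ w : Vel, ‖v‖ ≤ ‖w‖ → w ∈ dyadicExterior n :=
    fun n v hv w hw => le_trans (show (2 : ℝ) ^ n ≤ bracket v from hv) (bracket_le_of_norm_le hw)
  have hpm : Measurable fun v => ‖partialDeriv i f v‖ₑ :=
    (contDiff_partialDeriv i hf).continuous.enorm.measurable
  -- on `{2 ^ n ≤ ⟨v⟩}` the difference step is `δ 2 ^ (n a)`
  have hn : ∀ n : ℕ, ENNReal.ofReal (((2 : ℝ) ^ n) ^ (k + a)) *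
      ∫⁻ v in dyadicExterior n, ‖partialDeriv i f v‖ₑ ≤
      24 * (ENNReal.ofReal δ⁻¹ * (ENNReal.ofReal (((2 : ℝ) ^ n) ^ k) *
          ∫⁻ v in dyadicExterior n, ‖f v‖ₑ) +
        ENNReal.ofReal (δ ^ 3) * (ENNReal.ofReal (((2 : ℝ) ^ n) ^ (k + 4 * a)) *
          ∫⁻ v in dyadicExterior n, ‖(partialDeriv i)^[4] f v‖ₑ)) := by
    intro n
    set R : ℝ := (2 : ℝ) ^ n with hR
    have hR0 : 0 < R := by positivity
    have hRa : 0 < R ^ a := by positivity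
    have h := setLIntegral_partialDeriv_le hf i (measurableSet_dyadicExterior n) (hmono n)
      (by positivity : 0 < δ * R ^ a)
    refine (mul_le_mul_right h _).trans_eq ?_
    have e1 : ENNReal.ofReal (R ^ (k + a)) * ENNReal.ofReal (δ * R ^ a)⁻¹ =
        ENNReal.ofReal δ⁻¹ * ENNReal.ofReal (R ^ k) := by
      rw [← ENNReal.ofReal_mul (by positivity), ← ENNReal.ofReal_mul (by positivity),
        Real.rpow_add hR0]
      congr 1
      field_simp
    have e2 : ENNReal.ofReal (R ^ (k + a)) * ENNReal.ofReal ((δ * R ^ a) ^ 3) =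
        ENNReal.ofReal (δ ^ 3) * ENNReal.ofReal (R ^ (k + 4 * a)) := by
      rw [← ENNReal.ofReal_mul (by positivity), ← ENNReal.ofReal_mul (by positivity)]
      congr 1
      have : k + 4 * a = k + a + (a + a + a) := by ring
      rw [this, Real.rpow_add hR0 (k + a), Real.rpow_add hR0 (a + a), Real.rpow_add hR0 a]
      ring
    calc _ = 24 * ((ENNReal.ofReal (R ^ (k + a)) * ENNReal.ofReal (δ * R ^ a)⁻¹) *
            (∫⁻ v in dyadicExterior n, ‖f v‖ₑ) +
          (ENNReal.ofReal (R ^ (k + a)) * ENNReal.ofReal ((δ * R ^ a) ^ 3)) *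
            ∫⁻ v in dyadicExterior n, ‖(partialDeriv i)^[4] f v‖ₑ) := by ring
      _ = _ := by
        rw [e1, e2]
        ring
  have hA' := tsum_setLIntegral_dyadicExterior_le hk hf.continuous
  have hB' := tsum_setLIntegral_dyadicExterior_le (by linarith : 0 < k + 4 * a)
    (contDiff_iterate_partialDeriv i 4 hf).continuous
  set A := weightedLpNorm 1 (polyWeight k) f
  set B := weightedLpNorm 1 (polyWeight (k + 4 * a)) ((partialDeriv i)^[4] f)
  calc _ ≤ ∫⁻ v, ENNReal.ofReal (2 ^ (k + a)) * ((∑' n : ℕ, (dyadicExterior n).indicator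
        (fun _ => ENNReal.ofReal (((2 : ℝ) ^ n) ^ (k + a))) v) * ‖partialDeriv i f v‖ₑ) := by
        rw [weightedLpNorm_one_polyWeight]
        refine lintegral_mono fun v => ?_
        rw [mul_comm, ← mul_assoc]
        exact mul_le_mul_left (ofReal_polyWeight_le_tsum (by linarith) v) _
    _ = ENNReal.ofReal (2 ^ (k + a)) * ∑' n : ℕ, ENNReal.ofReal (((2 : ℝ) ^ n) ^ (k + a)) *
          ∫⁻ v in dyadicExterior n, ‖partialDeriv i f v‖ₑ := by
        rw [lintegral_const_mul' _ _ ENNReal.ofReal_ne_top, lintegral_tsum_dyadicExterior _ hpm]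
    _ ≤ ENNReal.ofReal (2 ^ (k + a)) * (24 * (ENNReal.ofReal δ⁻¹ * (c k * A) +
          ENNReal.ofReal (δ ^ 3) * (c (k + 4 * a) * B))) := by
        refine mul_le_mul_right ((ENNReal.tsum_le_tsum hn).trans ?_) _
        rw [ENNReal.tsum_mul_left, ENNReal.tsum_add, ENNReal.tsum_mul_left, ENNReal.tsum_mul_left]
        gcongr
    _ = ENNReal.ofReal (2 ^ (k + a)) * 24 * (c k * (ENNReal.ofReal δ⁻¹ * A) +
          c (k + 4 * a) * (ENNReal.ofReal (δ ^ 3) * B)) := by ring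
    _ ≤ ENNReal.ofReal (2 ^ (k + a)) * 24 * ((c k + c (k + 4 * a)) * (ENNReal.ofReal δ⁻¹ * A) +
          (c k + c (k + 4 * a)) * (ENNReal.ofReal (δ ^ 3) * B)) := by
        gcongr
        · exact le_self_add
        · exact le_add_self
    _ = _ := by
        rw [hD]
        ring

/-! ### The nonlinear estimate on smooth functions -/

theorem enorm_fderiv_le_sum (f : Vel → ℝ) (v : Vel) :
    ‖fderiv ℝ f v‖ₑ ≤ ∑ i, ‖partialDeriv i f v‖ₑ := by
  have h : ‖fderiv ℝ f v‖ ≤ ∑ i, ‖partialDeriv i f v‖ := by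
    refine ContinuousLinearMap.opNorm_le_bound _ (Finset.sum_nonneg fun _ _ => norm_nonneg _)
      fun x => ?_
    have hx : x = ∑ i, x i • (EuclideanSpace.single i (1 : ℝ) : Vel) := by
      ext j
      simp [Finset.sum_apply, Pi.single_apply]
    have e : fderiv ℝ f v x = ∑ i, x i * partialDeriv i f v := by
      conv_lhs => rw [hx]
      simp only [map_sum, map_smul, smul_eq_mul]
      rfl
    rw [e, Finset.sum_mul]
    refine (norm_sum_le _ _).trans (Finset.sum_le_sum fun i _ => ?_)
    rw [norm_mul, mul_comm]
    exact mul_le_mul_of_nonneg_left (PiLp.norm_apply_le x i) (norm_nonneg _)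
  simp only [← ofReal_norm]
  rw [← ENNReal.ofReal_sum_of_nonneg fun _ _ => norm_nonneg _]
  exact ENNReal.ofReal_le_ofReal h

theorem weightedLpNorm_norm_fderiv_le {f : Vel → ℝ} (hf : ContDiff ℝ ∞ f) (q : ℝ) :
    weightedLpNorm 1 (polyWeight q) (fun v => ‖fderiv ℝ f v‖) ≤
      ∑ i, weightedLpNorm 1 (polyWeight q) (partialDeriv i f) := by
  simp only [weightedLpNorm_one_polyWeight, enorm_norm]
  have hm : ∀ i, Measurable fun v => ‖partialDeriv i f v‖ₑ * ENNReal.ofReal (polyWeight q v) :=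
    fun i => (contDiff_partialDeriv i hf).continuous.enorm.measurable.mul
      (continuous_polyWeight q).measurable.ennreal_ofReal
  rw [← lintegral_finsetSum _ fun i _ => hm i]
  refine lintegral_mono fun v => ?_
  rw [← Finset.sum_mul]
  exact mul_le_mul_left (enorm_fderiv_le_sum f v) _

/-- The estimate of the collision operator for smooth functions. The quantity `B` dominates
the high order norms: the product of the two moments of order `k + γ + 1`, of `f` and of its
gradient, interpolates as `(A ^ (3 / 4) B ^ (1 / 4))²`. -/
theorem exists_lintegral_collisionIntegrand_le_of_smooth {γ s c : ℝ} (hγ : 0 < γ) (hs : 0 < s)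
    (hs1 : s < 1 / 2) (hc : 0 < c) {b : ℝ → ℝ} (hb : IsAngularFunction s c b) {k : ℝ}
    (hk : 0 < k) : ∃ C : ℝ≥0∞, C ≠ ⊤ ∧ ∀ (f : Vel → ℝ) (A B : ℝ≥0∞), ContDiff ℝ ∞ f → A ≠ ⊤ →
      B ≠ ⊤ → weightedLpNorm 1 (polyWeight k) f ≤ A →
      weightedLpNorm 1 (polyWeight (k + 4 * (γ + 1))) f ≤ B →
      (∀ i, weightedLpNorm 1 (polyWeight (k + 4 * (γ + 1))) ((partialDeriv i)^[4] f) ≤ B) →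
      ∫⁻ v, ∫⁻ vs, ∫⁻ σ : Sph, ‖collisionIntegrand (hardPotentialKernel γ b) f f v (vs, σ)‖ₑ *
        ENNReal.ofReal (polyWeight k v) ∂surfaceMeasure ≤
      C * (A ^ (3 / 2 : ℝ) * B ^ (1 / 2 : ℝ)) := by
  obtain ⟨C₁, hC₁, h₁⟩ := exists_lintegral_collisionIntegrand_le hγ hs hs1 hc hb hk.le
  obtain ⟨C₂, hC₂, h₂⟩ := exists_weightedLpNorm_partialDeriv_le hk (by linarith : 0 < γ + 1)
  refine ⟨C₁ * (3 * C₂), ENNReal.mul_ne_top hC₁ (ENNReal.mul_ne_top (by norm_num) hC₂),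
    fun f A B hf hA hB hfA hfB hfd => ?_⟩
  set X : ℝ≥0∞ := A ^ (3 / 4 : ℝ) * B ^ (1 / 4 : ℝ) with hX
  have hX2 : X * X = A ^ (3 / 2 : ℝ) * B ^ (1 / 2 : ℝ) := by
    rw [hX, mul_mul_mul_comm, ← ENNReal.rpow_add_of_nonneg _ _ (by norm_num) (by norm_num),
      ← ENNReal.rpow_add_of_nonneg _ _ (by norm_num) (by norm_num)]
    norm_num
  have e1 : weightedLpNorm 1 (polyWeight (k + (γ + 1))) f ≤ X :=
    (weightedLpNorm_one_interpolate hf.continuous k (γ + 1)).trans (by rw [hX]; gcongr)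
  have e2 : ∀ i, weightedLpNorm 1 (polyWeight (k + (γ + 1))) (partialDeriv i f) ≤ C₂ * X :=
    fun i => (h₂ f i hf (ne_top_of_le_ne_top hA hfA) (ne_top_of_le_ne_top hB (hfd i))).trans
      (by rw [hX]; gcongr; exact hfd i)
  have e3 : weightedLpNorm 1 (polyWeight (k + (γ + 1))) (fun v => ‖fderiv ℝ f v‖) ≤
      3 * (C₂ * X) := by
    refine (weightedLpNorm_norm_fderiv_le hf _).trans ((Finset.sum_le_sum fun i _ => e2 i).trans ?_)
    simp
  calc _ ≤ C₁ * (X * (3 * (C₂ * X))) := (h₁ f (hf.of_le (by simp))).trans (by gcongr)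
    _ = _ := by
      rw [← hX2]
      ring

/-! ### Mollification -/

open scoped Convolution in
/-- The mollification of `h` by the normalised bump function `φ`. -/
noncomputable def mollify (φ : ContDiffBump (0 : Vel)) (h : Vel → ℝ) : Vel → ℝ :=
  φ.normed volume ⋆[ContinuousLinearMap.lsmul ℝ ℝ, volume] h

theorem contDiff_mollify (φ : ContDiffBump (0 : Vel)) {h : Vel → ℝ}
    (hh : LocallyIntegrable h volume) : ContDiff ℝ ∞ (mollify φ h) :=
  φ.hasCompactSupport_normed.contDiff_convolution_left _ φ.contDiff_normed hh

theorem weightedLpNorm_mollify_le {q : ℝ} (hq : 0 ≤ q) {φ : ContDiffBump (0 : Vel)}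
    (hφ : φ.rOut ≤ 1) {g : Vel → ℝ} (hg : LocallyIntegrable g volume) :
    weightedLpNorm 1 (polyWeight q) (mollify φ g) ≤
      ENNReal.ofReal (2 ^ q) * weightedLpNorm 1 (polyWeight q) g := by
  wlog hgm : StronglyMeasurable g generalizing g
  · have hae := hg.aestronglyMeasurable.ae_eq_mk
    have h1 := this (hg.congr hae) hg.aestronglyMeasurable.stronglyMeasurable_mk
    have h2 : mollify φ g = mollify φ (hg.aestronglyMeasurable.mk g) :=
      convolution_congr _ (Filter.EventuallyEq.refl _ _) hae
    have h3 : weightedLpNorm 1 (polyWeight q) g =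
        weightedLpNorm 1 (polyWeight q) (hg.aestronglyMeasurable.mk g) :=
      eLpNorm_congr_ae (hae.mul (Filter.EventuallyEq.refl _ (polyWeight q)))
    rw [h2, h3]
    exact h1
  set ψ := φ.normed volume with hψ
  have hψ1 : ∫⁻ t, ‖ψ t‖ₑ = 1 := by
    have : ∀ t, ‖ψ t‖ₑ = ENNReal.ofReal (ψ t) := fun t =>
      Real.enorm_of_nonneg (φ.nonneg_normed t)
    simp only [this]
    rw [← ofReal_integral_eq_lintegral_ofReal φ.integrable_normed
      (Filter.Eventually.of_forall φ.nonneg_normed), φ.integral_normed, ENNReal.ofReal_one]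
  have hψm : Measurable fun t => ‖ψ t‖ₑ := φ.continuous_normed.enorm.measurable
  let G : Vel → ℝ≥0∞ := fun u => ‖g u‖ₑ * ENNReal.ofReal (polyWeight q u)
  have hG : Measurable G := hgm.measurable.enorm.mul
    (continuous_polyWeight q).measurable.ennreal_ofReal
  have hpt : ∀ v t, ‖ψ t • g (v - t)‖ₑ * ENNReal.ofReal (polyWeight q v) ≤
      ENNReal.ofReal (2 ^ q) * (‖ψ t‖ₑ * G (v - t)) := by
    intro v t
    by_cases ht : ‖t‖ < 1
    · have h1 : polyWeight q v ≤ 2 ^ q * polyWeight q (v - t) := by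
        rw [polyWeight, polyWeight, ← Real.mul_rpow (by norm_num) (bracket_pos _).le]
        refine Real.rpow_le_rpow (bracket_pos v).le ?_ hq
        have := bracket_le_add_norm_sub v (v - t)
        rw [sub_sub_cancel] at this
        linarith [one_le_bracket (v - t)]
      have h2 := ENNReal.ofReal_le_ofReal h1
      rw [ENNReal.ofReal_mul (by positivity)] at h2
      calc _ ≤ ‖ψ t‖ₑ * ‖g (v - t)‖ₑ *
            (ENNReal.ofReal (2 ^ q) * ENNReal.ofReal (polyWeight q (v - t))) := by
            rw [smul_eq_mul, enorm_mul]
            gcongr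
        _ = _ := by
            simp only [G]
            ring
    · have : ψ t = 0 := by
        rw [← Function.notMem_support, hψ, φ.support_normed_eq, Metric.mem_ball, dist_zero_right]
        linarith
      simp [this]
  have hm : Measurable fun x : Vel × Vel => ‖ψ x.2‖ₑ * G (x.1 - x.2) :=
    (hψm.comp measurable_snd).mul (hG.comp (measurable_fst.sub measurable_snd))
  rw [weightedLpNorm_one_polyWeight, weightedLpNorm_one_polyWeight]
  calc _ ≤ ∫⁻ v, ∫⁻ t, ENNReal.ofReal (2 ^ q) * (‖ψ t‖ₑ * G (v - t)) := by
        refine lintegral_mono fun v => ?_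
        refine (mul_le_mul_left (enorm_integral_le_lintegral_enorm _) _).trans ?_
        rw [← lintegral_mul_const' _ _ ENNReal.ofReal_ne_top]
        exact lintegral_mono fun t => hpt v t
    _ = ENNReal.ofReal (2 ^ q) * ∫⁻ t, ∫⁻ v, ‖ψ t‖ₑ * G (v - t) := by
        simp only [lintegral_const_mul' _ _ (ENNReal.ofReal_ne_top (r := 2 ^ q))]
        rw [lintegral_lintegral_swap hm.aemeasurable]
    _ = _ := by
        congr 1
        simp only [lintegral_const_mul' _ _ enorm_ne_top, lintegral_sub_right_eq_self G]
        rw [lintegral_mul_const _ hψm, hψ1, one_mul]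

open scoped Convolution in
theorem partialDeriv_convolution (i : Fin 3) {ψ h : Vel → ℝ} (hψ : ContDiff ℝ ∞ ψ)
    (hψc : HasCompactSupport ψ) (hh : LocallyIntegrable h volume) :
    partialDeriv i (ψ ⋆[ContinuousLinearMap.lsmul ℝ ℝ, volume] h) =
      partialDeriv i ψ ⋆[ContinuousLinearMap.lsmul ℝ ℝ, volume] h := by
  funext v
  have h1 := hψc.hasFDerivAt_convolution_right (ContinuousLinearMap.lsmul ℝ ℝ).flip hh
    (hψ.of_le (by simp)) v
  rw [convolution_flip] at h1
  rw [partialDeriv, h1.fderiv, convolution_precompR_apply _ hh (hψc.fderiv ℝ)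
    (hψ.continuous_fderiv (by simp)), convolution_flip]
  rfl

theorem hasCompactSupport_partialDeriv (i : Fin 3) {ψ : Vel → ℝ} (hψ : HasCompactSupport ψ) :
    HasCompactSupport (partialDeriv i ψ) :=
  hψ.fderiv_apply ℝ _

theorem hasCompactSupport_iterate_partialDeriv (i : Fin 3) (n : ℕ) {ψ : Vel → ℝ}
    (hψ : HasCompactSupport ψ) : HasCompactSupport ((partialDeriv i)^[n] ψ) := by
  induction n with
  | zero => exact hψ
  | succ n ih =>
    rw [Function.iterate_succ_apply']
    exact hasCompactSupport_partialDeriv i ih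

open scoped Convolution in
theorem iterate_partialDeriv_convolution (i : Fin 3) (n : ℕ) {ψ h : Vel → ℝ}
    (hψ : ContDiff ℝ ∞ ψ) (hψc : HasCompactSupport ψ) (hh : LocallyIntegrable h volume) :
    (partialDeriv i)^[n] (ψ ⋆[ContinuousLinearMap.lsmul ℝ ℝ, volume] h) =
      (partialDeriv i)^[n] ψ ⋆[ContinuousLinearMap.lsmul ℝ ℝ, volume] h := by
  induction n with
  | zero => rfl
  | succ n ih =>
    rw [Function.iterate_succ_apply', ih, Function.iterate_succ_apply',
      partialDeriv_convolution i (contDiff_iterate_partialDeriv i n hψ)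
        (hasCompactSupport_iterate_partialDeriv i n hψc) hh]

theorem iterate_partialDeriv_comp_sub (i : Fin 3) (n : ℕ) {ψ : Vel → ℝ} (hψ : ContDiff ℝ ∞ ψ)
    (v : Vel) : (partialDeriv i)^[n] (fun u => ψ (v - u)) =
      fun u => (-1) ^ n * (partialDeriv i)^[n] ψ (v - u) := by
  induction n with
  | zero => simp
  | succ n ih =>
    rw [Function.iterate_succ_apply', ih]
    funext u
    have h1 : HasFDerivAt (fun u : Vel => v - u) (-ContinuousLinearMap.id ℝ Vel) u :=
      (hasFDerivAt_id u).const_sub v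
    have h2 := ((contDiff_iterate_partialDeriv i n hψ).differentiable (by simp) (v - u)).hasFDerivAt
    have h3 : fderiv ℝ (fun u => (-1) ^ n * (partialDeriv i)^[n] ψ (v - u)) u = _ :=
      ((h2.comp u h1).const_mul ((-1) ^ n)).fderiv
    rw [partialDeriv, h3, Function.iterate_succ_apply', partialDeriv, pow_succ]
    simp

theorem iteratedPartial_single (i : Fin 3) (n : ℕ) (φ : Vel → ℝ) :
    iteratedPartial (Pi.single i n) φ = (partialDeriv i)^[n] φ := by
  fin_cases i <;> simp [iteratedPartial]

/-- Mollification commutes with weak derivatives, here those of order four in one direction. -/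
theorem iterate_partialDeriv_mollify (i : Fin 3) (φ : ContDiffBump (0 : Vel)) {h g : Vel → ℝ}
    (hg : IsWeakDeriv (Pi.single i 4) h g) :
    (partialDeriv i)^[4] (mollify φ h) = mollify φ g := by
  have hψ : ContDiff ℝ ∞ (φ.normed volume) := φ.contDiff_normed
  rw [mollify, iterate_partialDeriv_convolution i 4 hψ φ.hasCompactSupport_normed
    hg.locallyIntegrable]
  funext v
  have hχ : ContDiff ℝ ∞ fun u => φ.normed volume (v - u) := by fun_prop
  have hχc : HasCompactSupport fun u => φ.normed volume (v - u) :=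
    φ.hasCompactSupport_normed.comp_homeomorph (Homeomorph.subLeft v)
  have h1 := hg.integral_eq _ hχ hχc
  rw [iteratedPartial_single, iterate_partialDeriv_comp_sub i 4 hψ, Finset.sum_pi_single'] at h1
  rw [mollify, convolution_eq_swap, convolution_eq_swap]
  simp only [ContinuousLinearMap.lsmul_apply, smul_eq_mul]
  simp only [Finset.mem_univ, if_true] at h1
  rw [Even.neg_one_pow (by decide : Even 4), one_mul] at h1
  simp only [one_mul] at h1
  simpa only [mul_comm] using h1

/-! ### Weighted Sobolev norms -/

/-- By the Cauchy-Schwarz inequality, two powers of the weight pay for the passage from `L²` to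
`L¹` in dimension three. -/
theorem exists_weightedLpNorm_one_le_two (q : ℝ) : ∃ C : ℝ≥0∞, C ≠ ⊤ ∧ ∀ g : Vel → ℝ,
    AEStronglyMeasurable g volume →
      weightedLpNorm 1 (polyWeight q) g ≤ C * weightedLpNorm 2 (polyWeight (q + 2)) g := by
  let w : Vel → ℝ≥0∞ := fun v => ENNReal.ofReal (polyWeight (-2) v)
  refine ⟨(∫⁻ v, w v ^ (2 : ℝ)) ^ (1 / 2 : ℝ), ?_, fun g hg => ?_⟩
  · have hint : Integrable (fun v : Vel => (1 + ‖v‖ ^ 2) ^ (-(4 : ℝ) / 2)) volume := by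
      apply integrable_rpow_neg_one_add_norm_sq
      rw [finrank_euclideanSpace, Fintype.card_fin]
      norm_num
    have e : ∀ v : Vel, w v ^ (2 : ℝ) = ENNReal.ofReal ((1 + ‖v‖ ^ 2) ^ (-(4 : ℝ) / 2)) := by
      intro v
      simp only [w]
      rw [ENNReal.ofReal_rpow_of_nonneg (polyWeight_pos _ _).le (by norm_num), polyWeight, bracket,
        Real.sqrt_eq_rpow, ← Real.rpow_mul (by positivity), ← Real.rpow_mul (by positivity)]
      norm_num
    simp only [e]
    exact ENNReal.rpow_ne_top_of_nonneg (by norm_num) hint.lintegral_lt_top.ne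
  · have hgm : AEMeasurable (fun v => ‖g v * polyWeight (q + 2) v‖ₑ) volume :=
      (hg.mul (continuous_polyWeight (q + 2)).aestronglyMeasurable).enorm
    have hwm : AEMeasurable w volume :=
      (continuous_polyWeight (-2)).measurable.ennreal_ofReal.aemeasurable
    have hH : (2 : ℝ).HolderConjugate 2 := by
      rw [Real.holderConjugate_iff]
      norm_num
    have h := ENNReal.lintegral_mul_le_Lp_mul_Lq volume hH hwm hgm
    rw [weightedLpNorm, weightedLpNorm, eLpNorm_one_eq_lintegral_enorm,
      eLpNorm_eq_lintegral_rpow_enorm_toReal (by norm_num) (by norm_num), ENNReal.toReal_ofNat]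
    refine le_trans (le_of_eq (lintegral_congr fun v => ?_)) h
    simp only [Pi.mul_apply, w]
    rw [← Real.enorm_of_nonneg (polyWeight_pos (-2) v).le, ← enorm_mul]
    congr 1
    have : polyWeight q v = polyWeight (q + 2) v * polyWeight (-2) v := by
      rw [← polyWeight_add]
      congr 1
      ring
    rw [this]
    ring

theorem weightedLpNorm_weakDeriv_le {N : ℕ} {w h : Vel → ℝ} {α : Fin 3 → ℕ}
    (hα : α ∈ multiIndices N) : weightedLpNorm 2 w (weakDeriv α h) ≤ weightedHNorm N w h := by
  rw [weightedHNorm, weightedSobolevNorm, ENNReal.toReal_ofNat]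
  have h1 := Finset.single_le_sum (f := fun α => weightedLpNorm 2 w (weakDeriv α h) ^ (2 : ℝ))
    (fun _ _ => zero_le) hα
  refine le_trans (le_of_eq ?_) (ENNReal.rpow_le_rpow h1 (by norm_num : (0 : ℝ) ≤ 1 / 2))
  rw [← ENNReal.rpow_mul]
  norm_num

theorem weakDeriv_spec {α : Fin 3 → ℕ} {h : Vel → ℝ} (H : ∃ g, IsWeakDeriv α h g) :
    IsWeakDeriv α h (weakDeriv α h) := by
  rw [weakDeriv, dif_pos H]
  exact H.choose_spec

theorem IsWeakDeriv.ae_eq_of_zero {h g : Vel → ℝ} (H : IsWeakDeriv 0 h g) : h =ᵐ[volume] g := by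
  refine ae_eq_of_integral_contDiff_smul_eq H.locallyIntegrable H.locallyIntegrable_deriv
    fun φ hφ hφc => ?_
  have := H.integral_eq φ hφ hφc
  simp only [Pi.zero_apply, Finset.sum_const_zero, pow_zero, one_mul] at this
  have e : iteratedPartial 0 φ = φ := rfl
  rw [e] at this
  simpa only [smul_eq_mul, mul_comm] using this

theorem MemWeightedSobolev.weightedHNorm_ne_top {N : ℕ} {w h : Vel → ℝ}
    (H : MemWeightedH N w h) : weightedHNorm N w h ≠ ⊤ := by
  rw [weightedHNorm, weightedSobolevNorm]
  refine ENNReal.rpow_ne_top_of_nonneg (by positivity) (ENNReal.sum_ne_top.2 fun α hα => ?_)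
  exact ENNReal.rpow_ne_top_of_nonneg (by positivity) (H α hα).2.eLpNorm_ne_top

/-! ### Passage to the limit -/

/-- The measure `dv dv_* dσ`. -/
noncomputable abbrev collisionMeasure : Measure (Vel × Vel × Sph) :=
  (volume : Measure Vel).prod ((volume : Measure Vel).prod surfaceMeasure)

theorem lintegral_collisionMeasure {F : Vel × Vel × Sph → ℝ≥0∞}
    (hF : AEMeasurable F collisionMeasure) :
    ∫⁻ x, F x ∂collisionMeasure = ∫⁻ v, ∫⁻ p, F (v, p) ∂(volume.prod surfaceMeasure) :=
  lintegral_prod F hF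

theorem lintegral_collisionMeasure_of_measurable {F : Vel × Vel × Sph → ℝ≥0∞}
    (hF : Measurable F) :
    ∫⁻ x, F x ∂collisionMeasure = ∫⁻ v, ∫⁻ vs, ∫⁻ σ : Sph, F (v, vs, σ) ∂surfaceMeasure := by
  rw [lintegral_collisionMeasure hF.aemeasurable]
  exact lintegral_congr fun v => lintegral_prod _ (hF.comp measurable_prodMk_left).aemeasurable

theorem quasiMeasurePreserving_postVel :
    Measure.QuasiMeasurePreserving (fun x : Vel × Vel × Sph => postVel x.1 x.2.1 x.2.2)
      collisionMeasure volume := by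
  refine ⟨continuous_postVel.measurable, Measure.AbsolutelyContinuous.mk fun S hS h0 => ?_⟩
  rw [Measure.map_apply continuous_postVel.measurable hS,
    ← lintegral_indicator_one (continuous_postVel.measurable hS),
    lintegral_collisionMeasure_of_measurable
      (measurable_one.indicator (continuous_postVel.measurable hS))]
  have hm : Measurable fun x : Vel × Vel × Vel => S.indicator (1 : Vel → ℝ≥0∞) x.1 :=
    (measurable_one.indicator hS).comp measurable_fst
  refine (lintegral_postVel (F := fun v _ _ => S.indicator 1 v) hm).symm.trans ?_
  have hz : ∀ᵐ v : Vel, S.indicator (1 : Vel → ℝ≥0∞) v = 0 := by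
    filter_upwards [measure_eq_zero_iff_ae_notMem.1 h0] with v hv
    exact Set.indicator_of_notMem hv _
  refine (lintegral_congr_ae (g := 0) ?_).trans lintegral_zero
  filter_upwards [hz] with v hv
  simp [hv]

theorem quasiMeasurePreserving_postVelStar :
    Measure.QuasiMeasurePreserving (fun x : Vel × Vel × Sph => postVelStar x.1 x.2.1 x.2.2)
      collisionMeasure volume := by
  refine ⟨continuous_postVelStar.measurable, Measure.AbsolutelyContinuous.mk fun S hS h0 => ?_⟩
  rw [Measure.map_apply continuous_postVelStar.measurable hS,
    ← lintegral_indicator_one (continuous_postVelStar.measurable hS),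
    lintegral_collisionMeasure_of_measurable
      (measurable_one.indicator (continuous_postVelStar.measurable hS))]
  have hm : Measurable fun x : Vel × Vel × Vel => S.indicator (1 : Vel → ℝ≥0∞) x.2.1 :=
    (measurable_one.indicator hS).comp (measurable_fst.comp measurable_snd)
  refine (lintegral_postVel (F := fun _ vs _ => S.indicator 1 vs) hm).symm.trans ?_
  have hz : ∀ᵐ v : Vel, S.indicator (1 : Vel → ℝ≥0∞) v = 0 := by
    filter_upwards [measure_eq_zero_iff_ae_notMem.1 h0] with v hv
    exact Set.indicator_of_notMem hv _
  have hz2 : ∫⁻ vs : Vel, ∫⁻ _ : Sph, S.indicator (1 : Vel → ℝ≥0∞) vs ∂surfaceMeasure = 0 := by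
    refine (lintegral_congr_ae (g := 0) ?_).trans lintegral_zero
    filter_upwards [hz] with v hv
    simp [hv]
  exact (lintegral_congr fun _ => hz2).trans lintegral_zero

theorem quasiMeasurePreserving_snd_fst :
    Measure.QuasiMeasurePreserving (fun x : Vel × Vel × Sph => x.2.1) collisionMeasure volume :=
  Measure.quasiMeasurePreserving_fst.comp Measure.quasiMeasurePreserving_snd

/-- The collision integrand, on the space of all `(v, v_*, σ)`, with the weight `⟨v⟩^k`. -/
noncomputable def weightedIntegrand (γ k : ℝ) (b : ℝ → ℝ) (h : Vel → ℝ) (x : Vel × Vel × Sph) : ℝ :=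
  collisionIntegrand (hardPotentialKernel γ b) h h x.1 x.2 * polyWeight k x.1

theorem measurable_kernel_sub {γ s c : ℝ} {b : ℝ → ℝ} (hb : IsAngularFunction s c b) :
    Measurable fun x : Vel × Vel × Sph => hardPotentialKernel γ b (x.1 - x.2.1) x.2.2 :=
  Measurable.comp (g := fun x : Vel × Sph => hardPotentialKernel γ b x.1 x.2)
    (f := fun x : Vel × Vel × Sph => (x.1 - x.2.1, x.2.2)) (measurable_hardPotentialKernel hb)
    (by fun_prop)

theorem measurable_polyWeight_fst (k : ℝ) :
    Measurable fun x : Vel × Vel × Sph => polyWeight k x.1 :=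
  (continuous_polyWeight k).measurable.comp measurable_fst

theorem aestronglyMeasurable_weightedIntegrand {γ s c k : ℝ} {b : ℝ → ℝ}
    (hb : IsAngularFunction s c b) {h : Vel → ℝ} (hh : AEStronglyMeasurable h volume) :
    AEStronglyMeasurable (weightedIntegrand γ k b h) collisionMeasure := by
  have h1 := hh.comp_quasiMeasurePreserving quasiMeasurePreserving_postVel
  have h2 := hh.comp_quasiMeasurePreserving quasiMeasurePreserving_postVelStar
  have h3 := hh.comp_quasiMeasurePreserving quasiMeasurePreserving_snd_fst
  have h4 := hh.comp_quasiMeasurePreserving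
    (Measure.quasiMeasurePreserving_fst (μ := (volume : Measure Vel))
      (ν := (volume : Measure Vel).prod surfaceMeasure))
  exact ((measurable_kernel_sub hb).aestronglyMeasurable.mul ((h2.mul h1).sub (h3.mul h4))).mul
    (measurable_polyWeight_fst k).aestronglyMeasurable

theorem measurable_weightedIntegrand {γ s c k : ℝ} {b : ℝ → ℝ}
    (hb : IsAngularFunction s c b) {h : Vel → ℝ} (hh : Measurable h) :
    Measurable (weightedIntegrand γ k b h) := by
  have h1 := hh.comp continuous_postVel.measurable
  have h2 := hh.comp continuous_postVelStar.measurable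
  have h3 : Measurable fun x : Vel × Vel × Sph => h x.2.1 :=
    hh.comp (measurable_fst.comp measurable_snd)
  have h4 : Measurable fun x : Vel × Vel × Sph => h x.1 := hh.comp measurable_fst
  exact ((measurable_kernel_sub hb).mul ((h2.mul h1).sub (h3.mul h4))).mul
    (measurable_polyWeight_fst k)

theorem enorm_weightedIntegrand (γ k : ℝ) (b : ℝ → ℝ) (h : Vel → ℝ) (x : Vel × Vel × Sph) :
    ‖weightedIntegrand γ k b h x‖ₑ =
      ‖collisionIntegrand (hardPotentialKernel γ b) h h x.1 x.2‖ₑ *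
        ENNReal.ofReal (polyWeight k x.1) := by
  rw [weightedIntegrand, enorm_mul, Real.enorm_of_nonneg (polyWeight_pos _ _).le]

/-- Lower semicontinuity of the weighted collision integral under almost everywhere
convergence. -/
theorem lintegral_weightedIntegrand_le_of_tendsto {γ s c k : ℝ} {b : ℝ → ℝ}
    (hb : IsAngularFunction s c b) {h : Vel → ℝ} {f : ℕ → Vel → ℝ} (hf : ∀ n, Measurable (f n))
    (hlim : ∀ᵐ v, Filter.Tendsto (fun n => f n v) Filter.atTop (nhds (h v))) {K : ℝ≥0∞}
    (hK : ∀ n, ∫⁻ x, ‖weightedIntegrand γ k b (f n) x‖ₑ ∂collisionMeasure ≤ K) :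
    ∫⁻ x, ‖weightedIntegrand γ k b h x‖ₑ ∂collisionMeasure ≤ K := by
  have h1 := quasiMeasurePreserving_postVel.ae hlim
  have h2 := quasiMeasurePreserving_postVelStar.ae hlim
  have h3 := quasiMeasurePreserving_snd_fst.ae hlim
  have h4 := (Measure.quasiMeasurePreserving_fst (μ := (volume : Measure Vel))
      (ν := (volume : Measure Vel).prod surfaceMeasure)).ae hlim
  have hae : ∀ᵐ x ∂collisionMeasure, ‖weightedIntegrand γ k b h x‖ₑ =
      Filter.liminf (fun n => ‖weightedIntegrand γ k b (f n) x‖ₑ) Filter.atTop := by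
    filter_upwards [h1, h2, h3, h4] with x x1 x2 x3 x4
    refine (Filter.Tendsto.liminf_eq (Filter.Tendsto.enorm ?_)).symm
    exact (((x2.mul x1).sub (x3.mul x4)).const_mul _).mul_const _
  rw [lintegral_congr_ae hae]
  refine (lintegral_liminf_le fun n => (measurable_weightedIntegrand hb (hf n)).enorm).trans ?_
  exact Filter.liminf_le_of_le (by isBoundedDefault) fun a ha => by
    obtain ⟨n, hn⟩ := ha.exists
    exact hn.trans (hK n)

/-- The estimate of the collision operator with the absolute value inside the collision integral,
on the weighted Sobolev space. -/
theorem exists_lintegral_weightedIntegrand_le {γ s c : ℝ} (hγ : 0 < γ) (hs : 0 < s)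
    (hs1 : s < 1 / 2) (hc : 0 < c) {b : ℝ → ℝ} (hb : IsAngularFunction s c b) {k : ℝ}
    (hk : 0 < k) : ∃ C : ℝ≥0∞, C ≠ ⊤ ∧ ∀ h : Vel → ℝ,
      MemWeightedH 4 (polyWeight (4 * γ + k + 6)) h →
      ∫⁻ x, ‖weightedIntegrand γ k b h x‖ₑ ∂collisionMeasure ≤
        C * (weightedLpNorm 1 (polyWeight k) h ^ (3 / 2 : ℝ) *
          weightedHNorm 4 (polyWeight (4 * γ + k + 6)) h ^ (1 / 2 : ℝ)) ∧
      weightedLpNorm 1 (polyWeight k) h ≠ ⊤ := by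
  obtain ⟨C₁, hC₁, h₁⟩ := exists_lintegral_collisionIntegrand_le_of_smooth hγ hs hs1 hc hb hk
  set q : ℝ := k + 4 * (γ + 1) with hq
  obtain ⟨C₂, hC₂, h₂⟩ := exists_weightedLpNorm_one_le_two q
  set L : ℝ≥0∞ := ENNReal.ofReal (2 ^ q) with hL
  have hL' : L ≠ ⊤ := ENNReal.ofReal_ne_top
  have hLk : ENNReal.ofReal (2 ^ k) ≤ L := by
    apply ENNReal.ofReal_le_ofReal
    exact Real.rpow_le_rpow_of_exponent_le (by norm_num) (by linarith)
  refine ⟨C₁ * (L ^ (3 / 2 : ℝ) * (L * C₂) ^ (1 / 2 : ℝ)), ?_, fun h H => ?_⟩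
  · exact ENNReal.mul_ne_top hC₁ (ENNReal.mul_ne_top
      (ENNReal.rpow_ne_top_of_nonneg (by norm_num) hL')
      (ENNReal.rpow_ne_top_of_nonneg (by norm_num) (ENNReal.mul_ne_top hL' hC₂)))
  have hw : (4 * γ + k + 6) = q + 2 := by rw [hq]; ring
  rw [hw] at H ⊢
  set M := weightedHNorm 4 (polyWeight (q + 2)) h with hM
  have hMtop : M ≠ ⊤ := H.weightedHNorm_ne_top
  have h0mem : (0 : Fin 3 → ℕ) ∈ multiIndices 4 := mem_multiIndices.2 (by simp)
  have himem : ∀ i : Fin 3, (Pi.single i 4 : Fin 3 → ℕ) ∈ multiIndices 4 := fun i =>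
    mem_multiIndices.2 (by rw [Finset.sum_pi_single']; simp)
  have hbound : ∀ α ∈ multiIndices 4, weightedLpNorm 1 (polyWeight q) (weakDeriv α h) ≤ C₂ * M :=
    fun α hα => (h₂ _ (weakDeriv_spec (H α hα).1).locallyIntegrable_deriv.aestronglyMeasurable).trans
      (mul_le_mul_right (weightedLpNorm_weakDeriv_le hα) _)
  have hspec0 := weakDeriv_spec (H 0 h0mem).1
  have hloc : LocallyIntegrable h volume := hspec0.locallyIntegrable
  have hh : weightedLpNorm 1 (polyWeight q) h ≤ C₂ * M := by
    have : weightedLpNorm 1 (polyWeight q) h = weightedLpNorm 1 (polyWeight q) (weakDeriv 0 h) :=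
      eLpNorm_congr_ae (hspec0.ae_eq_of_zero.mul (Filter.EventuallyEq.refl _ (polyWeight q)))
    rw [this]
    exact hbound 0 h0mem
  set A := weightedLpNorm 1 (polyWeight k) h with hA
  have hAtop : A ≠ ⊤ := by
    refine ne_top_of_le_ne_top (ENNReal.mul_ne_top hC₂ hMtop) (le_trans ?_ hh)
    rw [hA, weightedLpNorm_one_polyWeight, weightedLpNorm_one_polyWeight]
    refine lintegral_mono fun v => mul_le_mul_right (ENNReal.ofReal_le_ofReal ?_) _
    exact Real.rpow_le_rpow_of_exponent_le (one_le_bracket v) (by linarith)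
  refine ⟨?_, hAtop⟩
  let φ : ℕ → ContDiffBump (0 : Vel) := fun n =>
    ⟨1 / ((n : ℝ) + 1) / 2, 1 / ((n : ℝ) + 1), by positivity, half_lt_self (by positivity)⟩
  have hφ1 : ∀ n, (φ n).rOut ≤ 1 := fun n => by
    change 1 / ((n : ℝ) + 1) ≤ 1
    rw [div_le_one (by positivity)]
    linarith [(Nat.cast_nonneg n : (0 : ℝ) ≤ n)]
  have hφ0 : Filter.Tendsto (fun n => (φ n).rOut) Filter.atTop (nhds 0) :=
    tendsto_one_div_add_atTop_nhds_zero_nat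
  have hφ2 : ∀ᶠ n in Filter.atTop, (φ n).rOut ≤ 2 * (φ n).rIn :=
    Filter.Eventually.of_forall fun n => by
      change 1 / ((n : ℝ) + 1) ≤ 2 * (1 / ((n : ℝ) + 1) / 2)
      linarith
  have hlim := ContDiffBump.ae_convolution_tendsto_right_of_locallyIntegrable hφ0 hφ2 hloc
  refine lintegral_weightedIntegrand_le_of_tendsto hb (f := fun n => mollify (φ n) h)
    (fun n => (contDiff_mollify (φ n) hloc).continuous.measurable) hlim fun n => ?_
  have hsm := contDiff_mollify (φ n) hloc
  rw [lintegral_collisionMeasure_of_measurable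
    (measurable_weightedIntegrand hb hsm.continuous.measurable).enorm]
  simp only [enorm_weightedIntegrand]
  refine (h₁ (mollify (φ n) h) (L * A) (L * (C₂ * M)) hsm (ENNReal.mul_ne_top hL' hAtop)
    (ENNReal.mul_ne_top hL' (ENNReal.mul_ne_top hC₂ hMtop)) ?_ ?_ fun i => ?_).trans_eq ?_
  · exact (weightedLpNorm_mollify_le hk.le (hφ1 n) hloc).trans (mul_le_mul_left hLk _)
  · exact (weightedLpNorm_mollify_le (by linarith) (hφ1 n) hloc).trans (mul_le_mul_right hh _)
  · have hwd := weakDeriv_spec (H _ (himem i)).1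
    rw [iterate_partialDeriv_mollify i (φ n) hwd]
    exact (weightedLpNorm_mollify_le (by linarith) (hφ1 n) hwd.locallyIntegrable_deriv).trans
      (mul_le_mul_right (hbound _ (himem i)) _)
  · rw [← mul_assoc L C₂ M, ENNReal.mul_rpow_of_nonneg L A (by norm_num),
      ENNReal.mul_rpow_of_nonneg (L * C₂) M (by norm_num)]
    ring

end Boltzmann

theorem corollary3 (γ s c : ℝ) (hγ₀ : 0 < γ) (hγ₁ : γ < 1) (hs₀ : 0 < s) (hs₁ : s < 1 / 2)
    (hc : 0 < c) (b : ℝ → ℝ) (hb : IsAngularFunction s c b) (k : ℝ) (hk : 2 < k) :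
    ∃ C : ℝ, 0 < C ∧ ∀ h : Vel → ℝ, MemWeightedH 4 (polyWeight (4 * γ + k + 6)) h →
      (∀ᵐ v : Vel, Integrable (collisionIntegrand (hardPotentialKernel γ b) h h v)
        ((volume : Measure Vel).prod surfaceMeasure)) ∧
      MemLp (fun v => collisionOperator (hardPotentialKernel γ b) h h v * polyWeight k v)
        1 volume ∧
      weightedLpNorm 1 (polyWeight k) (collisionOperator (hardPotentialKernel γ b) h h) ≤
        ENNReal.ofReal C *
          (weightedLpNorm 1 (polyWeight k) h ^ (3 / 2 : ℝ) *
              weightedLpNorm 1 (fun v => polyWeight (2 * γ) v * polyWeight k v) h ^ (1 / 2 : ℝ) +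
            weightedLpNorm 1 (polyWeight k) h ^ (3 / 2 : ℝ) *
              weightedHNorm 4 (polyWeight (4 * γ + k + 6)) h ^ (1 / 2 : ℝ)) := by
  obtain ⟨C, hC, hmain⟩ :=
    exists_lintegral_weightedIntegrand_le hγ₀ hs₀ hs₁ hc hb (by linarith : 0 < k)
  refine ⟨C.toReal + 1, by positivity, fun h H => ?_⟩
  obtain ⟨hle, hA⟩ := hmain h H
  have hmeas : AEStronglyMeasurable h volume :=
    (weakDeriv_spec (H 0 (mem_multiIndices.2 (by simp))).1).locallyIntegrable.aestronglyMeasurable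
  have hIm : AEStronglyMeasurable (weightedIntegrand γ k b h) collisionMeasure :=
    aestronglyMeasurable_weightedIntegrand hb hmeas
  have hI : Integrable (weightedIntegrand γ k b h) collisionMeasure := by
    refine ⟨hIm, lt_of_le_of_lt hle (ENNReal.mul_lt_top hC.lt_top (ENNReal.mul_lt_top ?_ ?_))⟩
    · exact (ENNReal.rpow_ne_top_of_nonneg (by norm_num) hA).lt_top
    · exact (ENNReal.rpow_ne_top_of_nonneg (by norm_num) H.weightedHNorm_ne_top).lt_top
  have hQ : ∀ v, ∫ p, weightedIntegrand γ k b h (v, p) ∂((volume : Measure Vel).prod surfaceMeasure) =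
      collisionOperator (hardPotentialKernel γ b) h h v * polyWeight k v := by
    intro v
    rw [collisionOperator, ← integral_mul_const]
    rfl
  refine ⟨?_, ?_, ?_⟩
  · filter_upwards [hI.prod_right_ae] with v hv
    have h1 := hv.mul_const (polyWeight k v)⁻¹
    refine h1.congr (Filter.Eventually.of_forall fun p => ?_)
    exact mul_inv_cancel_right₀ (polyWeight_pos k v).ne' _
  · rw [memLp_one_iff_integrable]
    simpa only [hQ] using hI.integral_prod_left
  · calc weightedLpNorm 1 (polyWeight k) (collisionOperator (hardPotentialKernel γ b) h h)
        = ∫⁻ v, ‖∫ p, weightedIntegrand γ k b h (v, p)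
            ∂((volume : Measure Vel).prod surfaceMeasure)‖ₑ := by
          rw [weightedLpNorm, eLpNorm_one_eq_lintegral_enorm]
          simp only [hQ]
      _ ≤ ∫⁻ v, ∫⁻ p, ‖weightedIntegrand γ k b h (v, p)‖ₑ
            ∂((volume : Measure Vel).prod surfaceMeasure) :=
          lintegral_mono fun v => enorm_integral_le_lintegral_enorm _
      _ = ∫⁻ x, ‖weightedIntegrand γ k b h x‖ₑ ∂collisionMeasure :=
          (lintegral_collisionMeasure hIm.enorm).symm
      _ ≤ _ := by
          refine hle.trans (mul_le_mul' ?_ le_add_self)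
          rw [← ENNReal.ofReal_toReal hC]
          exact ENNReal.ofReal_le_ofReal (by simp)
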